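/- **Theorem (Stability of ZO-GDM).** Let $H\in\mathbb{R}^{d\times d}$ be symmetric with $H\succeq 0$ and $H\neq 0$, with eigenvalues $\lambda_1\ge\dots\ge\lambda_d\ge 0$ (counted with multiplicity), and write $\lambda_{\max}(H)=\lambda_1$. Let $x^\star\in\mathbb{R}^d$, $c\in\mathbb{R}$, and let $$f_{\mathrm{quad}}(x)=c+\tfrac12 (x-x^\star)^\top H (x-x^\star).$$ Let $\beta\in[0,1)$, $\mu>0$, and let $u_0,u_1,\dots$ be i.i.d. random vectors with law $\mathcal N(0,I_d)$. For a step size $\eta>0$ and an initial point $x_0\in\mathbb{R}^d$, consider the ZO-GDM iterates on $f_{\mathrm{quad}}$: $m_0=0$ and $$m_{t+1}=\beta m_t+\frac{f_{\mathrm{quad}}(x_t+\mu u_t)-f_{\mathrm{quad}}(x_t-\mu u_t)}{2\mu}\,u_t,\qquad x_{t+1}=x_t-\eta\, m_{t+1}\qquad(t\ge 0).$$ Define the critical step sizes $$\eta^\star_{\mathrm{mean}}=\sup\Big\{\eta>0:\ \forall x_0\in\mathbb{R}^d,\ \sup_{t\ge0}\big\|\mathbb{E}[x_t-x^\star]\big\|<\infty\Big\},\qquad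 \eta^\star_{\mathrm{ms}}=\sup\Big\{\eta>0:\ \forall x_0\in\mathbb{R}^d,\ \sup_{t\ge0}\mathbb{E}\big[\|x_t-x^\star\|^2\big]<\infty\Big\}.$$ Then both suprema are finite and taken over nonempty sets, and $$\eta^\star_{\mathrm{mean}}=\frac{2(1+\beta)}{\lambda_{\max}(H)};$$ moreover, $\eta^\star_{\mathrm{ms}}$ is the unique $\eta>0$ satisfying $$\eta\lambda_{\max}(H)<1-\beta^2\qquad\text{and}\qquad \sum_{i=1}^d\frac{\eta\lambda_i}{2(1-\beta)\bigl(1-\frac{\eta\lambda_i}{1-\beta^2}\bigr)}=1,$$ and it satisfies $$\frac{2(1-\beta)}{\operatorname{Tr}(H)+\frac{2\lambda_{\max}(H)}{1+\beta}}\ \le\ \eta^\star_{\mathrm{ms}}\ \le\ \frac{2(1-\beta)}{\operatorname{Tr}(H)}.$$ -/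

import Mathlib

open MeasureTheory ProbabilityTheory

noncomputable section

namespace ZOGDM

/-- The quadratic Taylor model `c + ½ (x - x⋆)ᵀ H (x - x⋆)` around `x⋆`, where `c` is the value of
the loss at `x⋆` and `H` is its Hessian at `x⋆`. -/
def quadModel {d : ℕ} (c : ℝ) (xstar : EuclideanSpace ℝ (Fin d)) (H : Matrix (Fin d) (Fin d) ℝ)
    (x : EuclideanSpace ℝ (Fin d)) : ℝ :=
  c + 1 / 2 * ((x - xstar).ofLp ⬝ᵥ H.mulVec (x - xstar).ofLp)

/-- The symmetric two-point gradient estimator of `f` at `x` along the direction `u`, with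
smoothing parameter `μ`. -/
def twoPointEstimator {d : ℕ} (f : EuclideanSpace ℝ (Fin d) → ℝ) (μ : ℝ)
    (u x : EuclideanSpace ℝ (Fin d)) : EuclideanSpace ℝ (Fin d) :=
  ((f (x + μ • u) - f (x - μ • u)) / (2 * μ)) • u

/-- The state `(x_t, m_t)` of zeroth-order gradient descent with Polyak momentum on `f`, with step
size `η`, momentum parameter `β`, smoothing parameter `μ`, initial point `x₀`, initial momentum
`m₀ = 0` and search directions `u_0, u_1, …`:
`m_{t+1} = β m_t + ∇̂f(x_t)`, `x_{t+1} = x_t - η m_{t+1}`. -/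
def state {d : ℕ} (f : EuclideanSpace ℝ (Fin d) → ℝ) (η β μ : ℝ) (x₀ : EuclideanSpace ℝ (Fin d))
    (u : ℕ → EuclideanSpace ℝ (Fin d)) :
    ℕ → EuclideanSpace ℝ (Fin d) × EuclideanSpace ℝ (Fin d)
  | 0 => (x₀, 0)
  | t + 1 =>
    let x := (state f η β μ x₀ u t).1
    let m := (state f η β μ x₀ u t).2
    let m' := β • m + twoPointEstimator f μ (u t) x
    (x - η • m', m')

/-- The random iterate `x_t` when the search directions are the random vectors `u_0, u_1, …`. -/
def iterate {d : ℕ} {Ω : Type*} (f : EuclideanSpace ℝ (Fin d) → ℝ) (η β μ : ℝ)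
    (x₀ : EuclideanSpace ℝ (Fin d)) (u : ℕ → Ω → EuclideanSpace ℝ (Fin d)) (t : ℕ) (ω : Ω) :
    EuclideanSpace ℝ (Fin d) :=
  (state f η β μ x₀ (fun s => u s ω) t).1

/-- A family of random processes `X x₀ : ℕ → Ω → ℝᵈ`, indexed by the initial point `x₀`, is
linearly stable in the mean around `x⋆`: for every `x₀` the expectations `𝔼[X_t - x⋆]` exist and
`sup_t ‖𝔼[X_t - x⋆]‖ < ∞`. -/
def StableInMean {d : ℕ} {Ω : Type*} [MeasurableSpace Ω] (P : Measure Ω)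
    (xstar : EuclideanSpace ℝ (Fin d))
    (X : EuclideanSpace ℝ (Fin d) → ℕ → Ω → EuclideanSpace ℝ (Fin d)) : Prop :=
  ∀ x₀, (∀ t, Integrable (fun ω => X x₀ t ω - xstar) P) ∧
    BddAbove (Set.range fun t => ‖∫ ω, (X x₀ t ω - xstar) ∂P‖)

/-- The family is mean-square linearly stable around `x⋆`: for every `x₀` the second moments
`𝔼[‖X_t - x⋆‖²]` are finite and `sup_t 𝔼[‖X_t - x⋆‖²] < ∞`. -/
def StableInMeanSquare {d : ℕ} {Ω : Type*} [MeasurableSpace Ω] (P : Measure Ω)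
    (xstar : EuclideanSpace ℝ (Fin d))
    (X : EuclideanSpace ℝ (Fin d) → ℕ → Ω → EuclideanSpace ℝ (Fin d)) : Prop :=
  ∀ x₀, (∀ t, Integrable (fun ω => ‖X x₀ t ω - xstar‖ ^ 2) P) ∧
    BddAbove (Set.range fun t => ∫ ω, ‖X x₀ t ω - xstar‖ ^ 2 ∂P)

/-- The step sizes `η > 0` for which ZO-GDM on the quadratic model is linearly stable in the
mean. -/
def meanStableSteps {d : ℕ} {Ω : Type*} [MeasurableSpace Ω] (P : Measure Ω)
    (u : ℕ → Ω → EuclideanSpace ℝ (Fin d)) (c : ℝ) (xstar : EuclideanSpace ℝ (Fin d))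
    (H : Matrix (Fin d) (Fin d) ℝ) (β μ : ℝ) : Set ℝ :=
  {η | 0 < η ∧
    StableInMean P xstar (fun x₀ => iterate (quadModel c xstar H) η β μ x₀ u)}

/-- The step sizes `η > 0` for which ZO-GDM on the quadratic model is mean-square linearly
stable. -/
def msStableSteps {d : ℕ} {Ω : Type*} [MeasurableSpace Ω] (P : Measure Ω)
    (u : ℕ → Ω → EuclideanSpace ℝ (Fin d)) (c : ℝ) (xstar : EuclideanSpace ℝ (Fin d))
    (H : Matrix (Fin d) (Fin d) ℝ) (β μ : ℝ) : Set ℝ :=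
  {η | 0 < η ∧
    StableInMeanSquare P xstar (fun x₀ => iterate (quadModel c xstar H) η β μ x₀ u)}

/-- The largest eigenvalue of a real symmetric `d × d` matrix (`d ≥ 1`). -/
def lambdaMax {d : ℕ} {H : Matrix (Fin d) (Fin d) ℝ} (hH : H.IsHermitian) : ℝ :=
  ⨆ i, hH.eigenvalues i

/-- The equation and the constraint that characterize the mean-square critical step size. -/
def CriticalEquation {d : ℕ} {H : Matrix (Fin d) (Fin d) ℝ} (hH : H.IsHermitian) (β η : ℝ) :
    Prop :=
  η * lambdaMax hH < 1 - β ^ 2 ∧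
    ∑ i, η * hH.eigenvalues i /
      (2 * (1 - β) * (1 - η * hH.eigenvalues i / (1 - β ^ 2))) = 1

end ZOGDM

end

/-! On a quadratic the symmetric difference is exact: the estimator equals `⟪H (x - x⋆), u⟫ • u`,
with `u` independent of the current state. Projecting on an eigenbasis of `H` and integrating `u`
out with Gaussian moments of order two and four turns the statement into one about deterministic
linear recursions with parameters `κᵢ = η λᵢ`.

Mean. The modes decouple, each obeying `x (t+2) = (1 + β - κ) x (t+1) - β x t`. For `0 < κ < 2 (1 +
β)` a positive definite quadratic form in two consecutive values does not increase; for `κ > 2 (1 +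
β)` the sign-alternated sequence grows at least linearly.

Mean square. The modes interact only through the scalar forcing `T = ∑ κⱼ² aⱼ`, which comes from `‖H
(x - x⋆)‖²` in the fourth-moment identity. The form `lyapunov` has coefficients such that one step
changes it by `-2 κ (1 - β² - κ) a + (1 + β) T`, with no `b` or `c` term. Weighting mode `i` by `κᵢ
/ (2 (1 - β² - κᵢ))` makes the losses add up to exactly `T`, so the total `V` satisfies `V (t+1) = V
t + (φ - 1) T t`, where `φ` is the sum in the critical equation (`lyapunov_succ`,
`sum_lyapunov_succ`). If `φ < 1`, then `T` is summable and the moments stay bounded. If `φ > 1`,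
bounded moments would make `V` converge, hence `T → 0`, hence `V → 0`, although `V` is nondecreasing
from a positive value. If some `κᵢ ≥ 1 - β²`, the same contradiction arises from mode `i` alone.

Since `φ` is continuous and strictly increasing in `η` below the pole of the top mode, `φ = 1` has a
unique root there. Freezing the denominators at their extreme values gives the two explicit bounds.
Behaviour exactly at the critical steps is not needed, because only suprema are claimed. -/

open Filter Topology
open scoped RealInnerProductSpace

namespace ZOGDM

/-! ### Linear recursions for the first and second moments -/

/-- The first moments `x = 𝔼 θ`, `n = η 𝔼 m` of one eigen-mode with `κ = η λ`. -/
structure MeanRecursion (β κ : ℝ) (x n : ℕ → ℝ) : Prop where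
  n_zero : n 0 = 0
  n_succ : ∀ t, n (t + 1) = β * n t + κ * x t
  x_succ : ∀ t, x (t + 1) = x t - n (t + 1)

/-- The second moments `a = 𝔼 θᵢ²`, `b = η 𝔼 θᵢ mᵢ`, `c = η² 𝔼 mᵢ²` of all eigen-modes, with
`κᵢ = η λᵢ`. -/
structure MomentRecursion {ι : Type*} [Fintype ι] (β : ℝ) (κ : ι → ℝ) (a b c : ℕ → ι → ℝ) :
    Prop where
  nonneg : ∀ t i x y, 0 ≤ x ^ 2 * a t i + 2 * x * y * b t i + y ^ 2 * c t i
  b_zero : ∀ i, b 0 i = 0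
  c_zero : ∀ i, c 0 i = 0
  c_succ : ∀ t i, c (t + 1) i = β ^ 2 * c t i + 2 * β * κ i * b t i + 2 * κ i ^ 2 * a t i
    + ∑ j, κ j ^ 2 * a t j
  b_succ : ∀ t i, b (t + 1) i = β * b t i + κ i * a t i - c (t + 1) i
  a_succ : ∀ t i, a (t + 1) i = a t i - 2 * (β * b t i + κ i * a t i) + c (t + 1) i

/-! ### First moments: a scalar second-order recursion -/

namespace MeanRecursion

variable {β κ : ℝ} {x n : ℕ → ℝ}

lemma bounded (h : MeanRecursion β κ x n) (hβ0 : 0 ≤ β) (hβ1 : β < 1) (hκ0 : 0 ≤ κ)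
    (hκ : κ < 2 * (1 + β)) : ∃ C, ∀ t, x t ^ 2 ≤ C := by
  rcases hκ0.eq_or_lt with rfl | hκ0
  · have hn : ∀ t, n t = 0 := by
      intro t
      induction t with
      | zero => exact h.n_zero
      | succ t ih => rw [h.n_succ, ih]; ring
    refine ⟨x 0 ^ 2, fun t => ?_⟩
    induction t with
    | zero => exact le_rfl
    | succ t ih => rw [h.x_succ, hn, sub_zero]; exact ih
  -- This form has eigenvalues `κ` and `2 (1 + β) - κ`, so it is positive definite exactly in the
  -- claimed range; the smaller eigenvalue is the constant in `hlow`.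
  set V : ℕ → ℝ := fun t => (1 + β) * (x (t + 1) ^ 2 + x t ^ 2)
    - 2 * (1 + β - κ) * x (t + 1) * x t with hV
  have hstep : ∀ t, x (t + 2) = (1 + β - κ) * x (t + 1) - β * x t := by
    intro t
    have h1 := h.x_succ (t + 1)
    have h2 := h.n_succ (t + 1)
    have h3 := h.x_succ t
    linear_combination h1 - h2 - β * h3
  have hdec : ∀ t, V (t + 1) ≤ V t := by
    intro t
    have : V (t + 1) - V t = -((1 - β) * (x (t + 2) - x t) ^ 2) := by
      simp only [hV]
      linear_combination (2 * (x (t + 2) - x t)) * hstep t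
    nlinarith [mul_nonneg (sub_nonneg.2 hβ1.le) (sq_nonneg (x (t + 2) - x t))]
  have hV0 : ∀ t, V t ≤ V 0 := fun t => antitone_nat_of_succ_le hdec (Nat.zero_le t)
  have hlow : ∀ t, min κ (2 * (1 + β) - κ) * x t ^ 2 ≤ V t := by
    intro t
    rcases le_total 0 (x (t + 1) * x t) with hs | hs <;>
    rcases le_total (1 + β - κ) 0 with hs' | hs'
    · simp only [hV]
      nlinarith [mul_nonneg hs (neg_nonneg.2 hs'), sq_nonneg (x t), sq_nonneg (x (t + 1)),
        mul_nonneg (sub_nonneg.2 (min_le_right κ (2 * (1 + β) - κ))) (sq_nonneg (x t)),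
        mul_nonneg hβ0 (sq_nonneg (x (t + 1)))]
    · have e : V t = κ * (x (t + 1) ^ 2 + x t ^ 2) + (1 + β - κ) * (x (t + 1) - x t) ^ 2 := by
        simp only [hV]; ring
      nlinarith [mul_nonneg (sub_nonneg.2 (min_le_left κ (2 * (1 + β) - κ))) (sq_nonneg (x t)),
        mul_nonneg hs' (sq_nonneg (x (t + 1) - x t)), mul_nonneg hκ0.le (sq_nonneg (x (t + 1)))]
    · have e : V t = (2 * (1 + β) - κ) * (x (t + 1) ^ 2 + x t ^ 2)
          + (-(1 + β - κ)) * (x (t + 1) + x t) ^ 2 := by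
        simp only [hV]; ring
      nlinarith [mul_nonneg (sub_nonneg.2 (min_le_right κ (2 * (1 + β) - κ))) (sq_nonneg (x t)),
        mul_nonneg (neg_nonneg.2 hs') (sq_nonneg (x (t + 1) + x t)),
        mul_nonneg (sub_nonneg.2 hκ.le) (sq_nonneg (x (t + 1)))]
    · simp only [hV]
      nlinarith [mul_nonneg (neg_nonneg.2 hs) hs', sq_nonneg (x t), sq_nonneg (x (t + 1)),
        mul_nonneg (sub_nonneg.2 (min_le_left κ (2 * (1 + β) - κ))) (sq_nonneg (x t)),
        mul_nonneg hβ0 (sq_nonneg (x (t + 1)))]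
  have hpos : 0 < min κ (2 * (1 + β) - κ) := lt_min hκ0 (sub_pos.2 hκ)
  exact ⟨V 0 / min κ (2 * (1 + β) - κ), fun t => by
    rw [le_div_iff₀ hpos, mul_comm]; exact (hlow t).trans (hV0 t)⟩

lemma not_bounded (h : MeanRecursion β κ x n) (hβ0 : 0 ≤ β) (hκ : 2 * (1 + β) < κ)
    (hx0 : x 0 = 1) : ¬ ∃ C, ∀ t, |x t| ≤ C := by
  rintro ⟨C, hC⟩
  -- Past the threshold the unstable root is negative; removing the alternating sign leaves a
  -- sequence whose increments never drop below `δ`.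
  set y : ℕ → ℝ := fun t => (-1) ^ t * x t with hy
  have hstep : ∀ t, x (t + 2) = (1 + β - κ) * x (t + 1) - β * x t := by
    intro t
    have h1 := h.x_succ (t + 1)
    have h2 := h.n_succ (t + 1)
    have h3 := h.x_succ t
    linear_combination h1 - h2 - β * h3
  have hy2 : ∀ t, y (t + 2) = (κ - 1 - β) * y (t + 1) - β * y t := by
    intro t
    simp only [hy, hstep t]; ring
  set δ := κ - 2 * (1 + β) with hδ
  have hδ0 : 0 < δ := sub_pos.2 hκ
  have hy0 : y 0 = 1 := by simp [hy, hx0]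
  have hy1 : y 1 = κ - 1 := by
    have := h.x_succ 0
    rw [h.n_succ 0, h.n_zero, hx0] at this
    simp only [hy, zero_add] at this ⊢
    rw [this]; ring
  have key : ∀ t : ℕ, 1 ≤ y t ∧ δ ≤ y (t + 1) - y t := by
    intro t
    induction t with
    | zero => rw [zero_add, hy0, hy1]; constructor <;> linarith
    | succ t ih =>
      refine ⟨by linarith [ih.1, ih.2], ?_⟩
      have h1 : 1 ≤ y (t + 1) := by linarith [ih.1, ih.2]
      have e : y (t + 2) - y (t + 1) = δ * y (t + 1) + β * (y (t + 1) - y t) := by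
        rw [hy2, hδ]; ring
      have := mul_nonneg hβ0 (hδ0.le.trans ih.2)
      rw [e]
      nlinarith
  have hlin : ∀ t : ℕ, t * δ ≤ y t := by
    intro t
    induction t with
    | zero => rw [hy0]; norm_num
    | succ t ih => push_cast; linarith [(key t).2]
  obtain ⟨N, hN⟩ := exists_nat_gt (C / δ)
  rw [div_lt_iff₀ hδ0] at hN
  have h1 := hlin N
  have h2 : y N ≤ C := by
    refine (le_abs_self _).trans ?_
    simp only [hy, abs_mul, abs_pow, abs_neg, abs_one, one_pow, one_mul]
    exact hC N
  linarith

end MeanRecursion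

/-- The quadratic Lyapunov form of one eigen-mode. -/
def lyapunov (β κ a b c : ℝ) : ℝ :=
  ((1 - β) * (1 - β ^ 2) + 2 * β * κ) * a + (2 * β * κ - 2 * β * (1 - β ^ 2)) * b
    + β ^ 2 * (1 + β) * c

/-- Completing the square: multiplied by its leading coefficient `p`, the form is the moment form at
`(p, β κ - β (1 - β²))` plus `β² κ (2 + 2β - κ) c`. -/
lemma lyapunov_nonneg {β κ a b c : ℝ} (hβ0 : 0 ≤ β) (hβ1 : β < 1) (hκ0 : 0 ≤ κ)
    (hκ : κ ≤ 1 - β ^ 2) (h : ∀ x y, 0 ≤ x ^ 2 * a + 2 * x * y * b + y ^ 2 * c) :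
    0 ≤ lyapunov β κ a b c := by
  have hp : 0 < (1 - β) * (1 - β ^ 2) + 2 * β * κ := by
    have : 0 < (1 - β) * (1 - β ^ 2) := mul_pos (by linarith) (by nlinarith)
    positivity
  have hc : 0 ≤ c := by simpa using h 0 1
  have h1 := h ((1 - β) * (1 - β ^ 2) + 2 * β * κ) (β * κ - β * (1 - β ^ 2))
  have h2 : 0 ≤ β ^ 2 * κ * (2 + 2 * β - κ) * c := by
    have : 0 ≤ 2 + 2 * β - κ := by nlinarith
    positivity
  refine nonneg_of_mul_nonneg_right ?_ hp
  unfold lyapunov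
  linear_combination h1 + h2

/-! ### Second moments: modes coupled by a common forcing -/

namespace MomentRecursion

variable {ι : Type*} [Fintype ι] {β : ℝ} {κ : ι → ℝ} {a b c : ℕ → ι → ℝ}

lemma a_nonneg (h : MomentRecursion β κ a b c) (t : ℕ) (i : ι) : 0 ≤ a t i := by
  simpa using h.nonneg t i 1 0

lemma c_nonneg (h : MomentRecursion β κ a b c) (t : ℕ) (i : ι) : 0 ≤ c t i := by
  simpa using h.nonneg t i 0 1

lemma forcing_nonneg (h : MomentRecursion β κ a b c) (t : ℕ) : 0 ≤ ∑ j, κ j ^ 2 * a t j :=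
  Finset.sum_nonneg fun j _ => mul_nonneg (sq_nonneg _) (h.a_nonneg t j)

lemma lyapunov_succ (h : MomentRecursion β κ a b c) (t : ℕ) (i : ι) :
    lyapunov β (κ i) (a (t + 1) i) (b (t + 1) i) (c (t + 1) i) =
      lyapunov β (κ i) (a t i) (b t i) (c t i) - 2 * κ i * (1 - β ^ 2 - κ i) * a t i
        + (1 + β) * ∑ j, κ j ^ 2 * a t j := by
  rw [h.a_succ, h.b_succ, h.c_succ, lyapunov, lyapunov]
  ring

/-- With the weights `κᵢ / (2 (1 - β² - κᵢ))` the total Lyapunov function changes by a multiple of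
the forcing term. -/
lemma sum_lyapunov_succ (h : MomentRecursion β κ a b c) (hκ : ∀ i, κ i < 1 - β ^ 2) (t : ℕ) :
    ∑ i, κ i / (2 * (1 - β ^ 2 - κ i)) *
        lyapunov β (κ i) (a (t + 1) i) (b (t + 1) i) (c (t + 1) i) =
      ∑ i, κ i / (2 * (1 - β ^ 2 - κ i)) * lyapunov β (κ i) (a t i) (b t i) (c t i)
        + (∑ i, (1 + β) * κ i / (2 * (1 - β ^ 2 - κ i)) - 1) * ∑ j, κ j ^ 2 * a t j := by
  have e : ∀ i, κ i / (2 * (1 - β ^ 2 - κ i)) *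
        lyapunov β (κ i) (a (t + 1) i) (b (t + 1) i) (c (t + 1) i) =
      κ i / (2 * (1 - β ^ 2 - κ i)) * lyapunov β (κ i) (a t i) (b t i) (c t i)
        - κ i ^ 2 * a t i
        + (1 + β) * κ i / (2 * (1 - β ^ 2 - κ i)) * ∑ j, κ j ^ 2 * a t j := by
    intro i
    have : 1 - β ^ 2 - κ i ≠ 0 := (sub_pos.2 (hκ i)).ne'
    rw [h.lyapunov_succ]
    field_simp
  simp_rw [e, Finset.sum_add_distrib, Finset.sum_sub_distrib, ← Finset.sum_mul]
  ring

lemma bounded (h : MomentRecursion β κ a b c) (hβ0 : 0 ≤ β) (hβ1 : β < 1) (hκ0 : ∀ i, 0 ≤ κ i)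
    (hκ : ∀ i, κ i < 1 - β ^ 2) (hφ : ∑ i, (1 + β) * κ i / (2 * (1 - β ^ 2 - κ i)) < 1) (i : ι) :
    ∃ C, ∀ t, a t i ≤ C := by
  set φ := ∑ i, (1 + β) * κ i / (2 * (1 - β ^ 2 - κ i)) with hφd
  set T : ℕ → ℝ := fun t => ∑ j, κ j ^ 2 * a t j with hT
  set V : ℕ → ℝ := fun t => ∑ i, κ i / (2 * (1 - β ^ 2 - κ i)) *
    lyapunov β (κ i) (a t i) (b t i) (c t i) with hV
  have hT0 : ∀ t, 0 ≤ T t := h.forcing_nonneg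
  have hQ0 : ∀ t i, 0 ≤ lyapunov β (κ i) (a t i) (b t i) (c t i) := fun t i =>
    lyapunov_nonneg hβ0 hβ1 (hκ0 i) (hκ i).le (h.nonneg t i)
  have hV0 : ∀ t, 0 ≤ V t := fun t => Finset.sum_nonneg fun i _ =>
    mul_nonneg (div_nonneg (hκ0 i) (by linarith [hκ i])) (hQ0 t i)
  have hsum : ∀ t, V t + (1 - φ) * ∑ s ∈ Finset.range t, T s = V 0 := by
    intro t
    induction t with
    | zero => simp
    | succ t ih =>
      rw [Finset.sum_range_succ, ← ih]
      have := h.sum_lyapunov_succ hκ t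
      simp only [hV, hT, hφd] at this ⊢
      rw [this]; ring
  have hS : ∀ t, ∑ s ∈ Finset.range t, T s ≤ V 0 / (1 - φ) := by
    intro t
    rw [le_div_iff₀ (sub_pos.2 hφ)]
    linarith [hsum t, hV0 t]
  have hTb : ∀ t, T t ≤ V 0 / (1 - φ) := fun t =>
    (Finset.single_le_sum (f := T) (fun s _ => hT0 s) (Finset.self_mem_range_succ t)).trans
      (hS (t + 1))
  set M := V 0 / (1 - φ)
  rcases (hκ0 i).eq_or_lt with hi | hi
  · -- no curvature in this direction
    -- With `κ i = 0` the forcing does not control `a`. Instead `c` and the Lyapunov form are both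
    -- driven by the summable forcing alone.
    have hc : ∀ t, c t i ≤ M := by
      intro t
      have : c t i ≤ ∑ s ∈ Finset.range t, T s := by
        induction t with
        | zero => simp [h.c_zero]
        | succ t ih =>
          rw [Finset.sum_range_succ, h.c_succ, ← hi]
          have h1 : β ^ 2 * c t i ≤ c t i :=
            mul_le_of_le_one_left (h.c_nonneg t i) (by nlinarith)
          simp only [hT] at ih ⊢
          nlinarith
      exact this.trans (hS t)
    have hQ : ∀ t, lyapunov β (κ i) (a t i) (b t i) (c t i)
        ≤ lyapunov β (κ i) (a 0 i) (b 0 i) (c 0 i) + (1 + β) * M := by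
      intro t
      have : lyapunov β (κ i) (a t i) (b t i) (c t i) =
          lyapunov β (κ i) (a 0 i) (b 0 i) (c 0 i) + (1 + β) * ∑ s ∈ Finset.range t, T s := by
        induction t with
        | zero => simp
        | succ t ih =>
          rw [h.lyapunov_succ, ih, Finset.sum_range_succ, ← hi]
          simp only [hT]; ring
      rw [this]
      have := mul_le_mul_of_nonneg_left (hS t) (by linarith : 0 ≤ 1 + β)
      linarith
    set N := lyapunov β (κ i) (a 0 i) (b 0 i) (c 0 i) + (1 + β) * M
    refine ⟨(2 * N / (1 + β) + 2 * β ^ 2 * M) / (1 - β) ^ 2, fun t => ?_⟩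
    have hβ2 : 0 < (1 - β) ^ 2 := pow_pos (sub_pos.2 hβ1) 2
    rw [le_div_iff₀ hβ2]
    -- For `κ = 0` the form divided by `1 + β` is the second moment of `A - B`, where `A = (1 - β)
    -- θ` and `B = β η m`. Then `A² ≤ 2 (A - B)² + 2 B²`, with slack `(A - 2 B)²`, which is this
    -- instance.
    have h1 := h.nonneg t i (1 - β) (-2 * β)
    have h2 : (lyapunov β (κ i) (a t i) (b t i) (c t i)) / (1 + β) =
        (1 - β) ^ 2 * a t i - 2 * β * (1 - β) * b t i + β ^ 2 * c t i := by
      have : 1 + β ≠ 0 := by linarith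
      rw [← hi, lyapunov]; field_simp; ring
    have h3 : 2 * (lyapunov β (κ i) (a t i) (b t i) (c t i)) / (1 + β) ≤ 2 * N / (1 + β) := by
      have := hQ t
      gcongr
    rw [mul_div_assoc, h2] at h3
    nlinarith [mul_le_mul_of_nonneg_left (hc t) (sq_nonneg β)]
  · refine ⟨M / κ i ^ 2, fun t => ?_⟩
    rw [le_div_iff₀ (pow_pos hi 2), mul_comm]
    exact (Finset.single_le_sum (f := fun j => κ j ^ 2 * a t j)
      (fun j _ => mul_nonneg (sq_nonneg _) (h.a_nonneg t j)) (Finset.mem_univ i)).trans (hTb t)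

/-- A weighted Lyapunov function that starts positive and grows at least like the forcing term is
incompatible with bounded second moments. -/
lemma not_bounded_of_lyapunov_growth (h : MomentRecursion β κ a b c) (ω : ι → ℝ)
    (hω : ∀ i, ω i ≠ 0 → κ i ≠ 0) {ε : ℝ} (hε : 0 < ε)
    (hgrow : ∀ t, ∑ i, ω i * lyapunov β (κ i) (a t i) (b t i) (c t i)
        + ε * ∑ j, κ j ^ 2 * a t j
      ≤ ∑ i, ω i * lyapunov β (κ i) (a (t + 1) i) (b (t + 1) i) (c (t + 1) i))
    (hpos : 0 < ∑ i, ω i * lyapunov β (κ i) (a 0 i) (b 0 i) (c 0 i)) :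
    ¬ ∀ i, ∃ C, ∀ t, a t i ≤ C := by
  intro hbdd
  set T : ℕ → ℝ := fun t => ∑ j, κ j ^ 2 * a t j with hT
  set V : ℕ → ℝ := fun t => ∑ i, ω i * lyapunov β (κ i) (a t i) (b t i) (c t i) with hV
  have hT0 : ∀ t, 0 ≤ T t := h.forcing_nonneg
  have hmono : Monotone V := monotone_nat_of_le_succ fun t =>
    (le_add_of_nonneg_right (mul_nonneg hε.le (hT0 t))).trans (hgrow t)
  -- As `η m (t+1) = θ t - θ (t+1)`, this is `(p - q)² ≤ 2 (p² + q²)`, and `hab` is polarization. So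
  -- `a` at two consecutive times controls `b` and `c`, which explains the shifted index below.
  have hac : ∀ t i, c (t + 1) i ≤ 2 * (a t i + a (t + 1) i) := by
    intro t i
    have h1 := h.nonneg (t + 1) i 2 1
    have h2 := h.a_succ t i
    have h3 := h.b_succ t i
    nlinarith
  have hab : ∀ t i, b (t + 1) i = (a t i - a (t + 1) i - c (t + 1) i) / 2 := by
    intro t i
    linarith [h.a_succ t i, h.b_succ t i]
  have hVb : BddAbove (Set.range V) := by
    choose A hA using hbdd
    have : BddAbove (Set.range fun t => V (t + 1)) := by
      refine ⟨∑ i, |ω i| * (|(1 - β) * (1 - β ^ 2) + 2 * β * κ i| * A i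
        + |2 * β * κ i - 2 * β * (1 - β ^ 2)| * (3 * A i) + |β ^ 2 * (1 + β)| * (4 * A i)), ?_⟩
      rintro _ ⟨t, rfl⟩
      refine Finset.sum_le_sum fun i _ => (le_abs_self _).trans ?_
      rw [abs_mul]
      refine mul_le_mul_of_nonneg_left ?_ (abs_nonneg _)
      have a0 := h.a_nonneg t i
      have a1 := h.a_nonneg (t + 1) i
      have c1 := h.c_nonneg (t + 1) i
      have hb : |b (t + 1) i| ≤ 3 * A i := by
        rw [hab, abs_le]; constructor <;> linarith [hA i t, hA i (t + 1), hac t i]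
      have hc : |c (t + 1) i| ≤ 4 * A i := by
        rw [abs_of_nonneg c1]; linarith [hA i t, hA i (t + 1), hac t i]
      have ha : |a (t + 1) i| ≤ A i := by rw [abs_of_nonneg a1]; exact hA i _
      unfold lyapunov
      refine (abs_add_three _ _ _).trans ?_
      simp only [abs_mul _ (a (t + 1) i), abs_mul _ (b (t + 1) i), abs_mul _ (c (t + 1) i)]
      gcongr
    obtain ⟨C, hC⟩ := this
    exact ⟨C, by rintro _ ⟨t, rfl⟩; exact (hmono t.le_succ).trans (hC ⟨t, rfl⟩)⟩
  have hlim := tendsto_atTop_ciSup hmono hVb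
  have hdiff : Tendsto (fun t => (V (t + 1) - V t) / ε) atTop (𝓝 0) := by
    simpa using ((hlim.comp (tendsto_add_atTop_nat 1)).sub hlim).div_const ε
  have hTlim : Tendsto T atTop (𝓝 0) :=
    squeeze_zero hT0 (fun t => by rw [le_div_iff₀ hε]; linarith [hgrow t]) hdiff
  have ha : ∀ i, ω i ≠ 0 → Tendsto (fun t => a t i) atTop (𝓝 0) := by
    intro i hi
    have hi := hω i hi
    refine squeeze_zero (fun t => h.a_nonneg t i) (g := fun t => T t / κ i ^ 2) (fun t => ?_)
      (by simpa using hTlim.div_const (κ i ^ 2))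
    rw [le_div_iff₀ (by positivity), mul_comm]
    exact Finset.single_le_sum (f := fun j => κ j ^ 2 * a t j)
      (fun j _ => mul_nonneg (sq_nonneg _) (h.a_nonneg t j)) (Finset.mem_univ i)
  have hV0 : Tendsto (fun t => V (t + 1)) atTop (𝓝 0) := by
    have : Tendsto (fun t => V (t + 1)) atTop (𝓝 (∑ _i : ι, (0 : ℝ))) := by
      refine tendsto_finsetSum _ fun i _ => ?_
      by_cases hi : ω i = 0
      · simp [hi]
      have a0 := ha i hi
      have a1 := a0.comp (tendsto_add_atTop_nat 1)
      have c1 : Tendsto (fun t => c (t + 1) i) atTop (𝓝 0) :=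
        squeeze_zero (fun t => h.c_nonneg _ i) (fun t => hac t i)
          (by simpa using (a0.add a1).const_mul 2)
      have b1 : Tendsto (fun t => b (t + 1) i) atTop (𝓝 0) := by
        simp_rw [hab]
        simpa using ((a0.sub a1).sub c1).div_const 2
      unfold lyapunov
      simpa using (((a1.const_mul _).add (b1.const_mul _)).add (c1.const_mul _)).const_mul (ω i)
    simpa using this
  exact absurd (ge_of_tendsto' hV0 fun t => hmono (Nat.zero_le (t + 1))) (not_le.2 hpos)

lemma lyapunov_zero (h : MomentRecursion β κ a b c) (i : ι) :
    lyapunov β (κ i) (a 0 i) (b 0 i) (c 0 i) = ((1 - β) * (1 - β ^ 2) + 2 * β * κ i) * a 0 i := by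
  rw [h.b_zero, h.c_zero, lyapunov]; ring

lemma lyapunov_zero_pos (h : MomentRecursion β κ a b c) (hβ0 : 0 ≤ β) (hβ1 : β < 1) {i : ι}
    (hκ0 : 0 ≤ κ i) (ha : 0 < a 0 i) : 0 < lyapunov β (κ i) (a 0 i) (b 0 i) (c 0 i) := by
  rw [h.lyapunov_zero]
  have : 0 < (1 - β) * (1 - β ^ 2) := mul_pos (by linarith) (by nlinarith)
  positivity

/-- Here the term `-2 κ (1 - β² - κ) a` is nonnegative, so the form of mode `i` alone grows by at
least `(1 + β) T`. The form need not be nonnegative at later times; only its initial value matters.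
-/
lemma not_bounded_of_le (h : MomentRecursion β κ a b c) (hβ0 : 0 ≤ β) (hβ1 : β < 1) {i : ι}
    (hκ : 1 - β ^ 2 ≤ κ i) (ha : 0 < a 0 i) : ¬ ∀ i, ∃ C, ∀ t, a t i ≤ C := by
  classical
  have hi : 0 < κ i := lt_of_lt_of_le (by nlinarith) hκ
  have e : ∀ f : ι → ℝ, ∑ j, (Pi.single i 1 : ι → ℝ) j * f j = f i := fun f => by
    simp [Pi.single_apply]
  refine h.not_bounded_of_lyapunov_growth (Pi.single i 1) ?_ (ε := 1 + β) (by linarith) ?_ ?_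
  · intro j hj
    by_cases hij : j = i
    · rw [hij]; exact hi.ne'
    · simp [hij] at hj
  · intro t
    rw [e, e, h.lyapunov_succ]
    have : 0 ≤ 2 * κ i * (κ i - (1 - β ^ 2)) * a t i :=
      mul_nonneg (mul_nonneg (by positivity) (sub_nonneg.2 hκ)) (h.a_nonneg t i)
    linarith
  · rw [e]
    exact h.lyapunov_zero_pos hβ0 hβ1 hi.le ha

lemma not_bounded_of_one_lt (h : MomentRecursion β κ a b c) (hβ0 : 0 ≤ β) (hβ1 : β < 1)
    (hκ0 : ∀ i, 0 ≤ κ i) (hκ : ∀ i, κ i < 1 - β ^ 2)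
    (hφ : 1 < ∑ i, (1 + β) * κ i / (2 * (1 - β ^ 2 - κ i))) {i : ι} (hi : 0 < κ i)
    (ha : 0 < a 0 i) : ¬ ∀ i, ∃ C, ∀ t, a t i ≤ C := by
  refine h.not_bounded_of_lyapunov_growth (fun i => κ i / (2 * (1 - β ^ 2 - κ i)))
    (fun i hi h0 => hi (by simp [h0])) (sub_pos.2 hφ) (fun t => (h.sum_lyapunov_succ hκ t).ge) ?_
  refine Finset.sum_pos' (fun j _ => mul_nonneg (div_nonneg (hκ0 j) (by linarith [hκ j])) ?_)
    ⟨i, Finset.mem_univ i, mul_pos (div_pos hi (by linarith [hκ i])) ?_⟩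
  · exact lyapunov_nonneg hβ0 hβ1 (hκ0 j) (hκ j).le (h.nonneg 0 j)
  · exact h.lyapunov_zero_pos hβ0 hβ1 hi.le ha

end MomentRecursion

/-! ### Moments of the standard Gaussian -/

lemma hasDerivAt_mul_exp_sq {f : ℝ → ℝ} {f' v t : ℝ} (hf : HasDerivAt f f' t) :
    HasDerivAt (fun t => f t * Real.exp (v * t ^ 2 / 2))
      ((f' + f t * (v * t)) * Real.exp (v * t ^ 2 / 2)) t := by
  have h : HasDerivAt (fun t : ℝ => v * t ^ 2 / 2) (v * t) t := by
    exact (((hasDerivAt_pow 2 t).const_mul v).div_const 2).congr_deriv (by push_cast; ring)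
  exact (hf.mul h.exp).congr_deriv (by ring)

/-- Fourth derivative at zero of the moment generating function `exp (v t² / 2)`. -/
lemma integral_pow_four_gaussianReal (v : NNReal) :
    ∫ x, x ^ 4 ∂(gaussianReal 0 v) = 3 * (v : ℝ) ^ 2 := by
  have h := iteratedDeriv_mgf_zero (X := id) (μ := gaussianReal 0 v)
    (by rw [integrableExpSet_id_gaussianReal]; simp) 4
  have e : (id ^ 4 : ℝ → ℝ) = fun x => x ^ 4 := rfl
  rw [e] at h
  rw [← h, mgf_id_gaussianReal]
  have d0 : deriv (fun t : ℝ => Real.exp ((0 : ℝ) * t + v * t ^ 2 / 2)) =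
      fun t => (v * t) * Real.exp (v * t ^ 2 / 2) := by
    funext t
    have := (hasDerivAt_mul_exp_sq (v := v) (hasDerivAt_const t (1 : ℝ))).deriv
    simpa using this
  have d1 : deriv (fun t : ℝ => (v * t) * Real.exp (v * t ^ 2 / 2)) =
      fun t => (v + v ^ 2 * t ^ 2) * Real.exp (v * t ^ 2 / 2) := by
    funext t
    have := (hasDerivAt_mul_exp_sq (v := v) ((hasDerivAt_id t).const_mul (v : ℝ))).deriv
    simp only [id] at this
    rw [this]; ring
  have d2 : deriv (fun t : ℝ => (v + v ^ 2 * t ^ 2) * Real.exp (v * t ^ 2 / 2)) =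
      fun t => (3 * v ^ 2 * t + v ^ 3 * t ^ 3) * Real.exp (v * t ^ 2 / 2) := by
    funext t
    rw [(hasDerivAt_mul_exp_sq (v := v)
      (((hasDerivAt_pow 2 t).const_mul ((v : ℝ) ^ 2)).const_add (v : ℝ))).deriv]
    norm_num; ring
  have d3 : deriv (fun t : ℝ => (3 * v ^ 2 * t + v ^ 3 * t ^ 3) * Real.exp (v * t ^ 2 / 2)) =
      fun t => (3 * v ^ 2 + 6 * v ^ 3 * t ^ 2 + v ^ 4 * t ^ 4) * Real.exp (v * t ^ 2 / 2) := by
    funext t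
    have := (hasDerivAt_mul_exp_sq (v := v)
      (((hasDerivAt_id t).const_mul (3 * (v : ℝ) ^ 2)).add
        ((hasDerivAt_pow 3 t).const_mul ((v : ℝ) ^ 3)))).deriv
    simp only [id, Pi.add_apply] at this
    rw [this]; norm_num; ring
  simp only [iteratedDeriv_succ, iteratedDeriv_zero, d0, d1, d2, d3]
  simp

section

variable {E : Type*} [NormedAddCommGroup E] [InnerProductSpace ℝ E] [FiniteDimensional ℝ E]
  [MeasurableSpace E] [BorelSpace E]

lemma map_inner_stdGaussian (y : E) :
    (stdGaussian E).map (fun u => ⟪y, u⟫) = gaussianReal 0 (‖y‖₊ ^ 2) := by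
  have h := IsGaussian.map_eq_gaussianReal (μ := stdGaussian E) (innerSL ℝ y)
  rw [integral_strongDual_stdGaussian, variance_dual_stdGaussian, innerSL_apply_norm] at h
  have e : (‖y‖ ^ 2).toNNReal = ‖y‖₊ ^ 2 := by
    rw [Real.toNNReal_pow (norm_nonneg _), norm_toNNReal]
  rw [e] at h
  exact h

lemma integrable_norm_pow_stdGaussian (k : ℕ) :
    Integrable (fun u : E => ‖u‖ ^ k) (stdGaussian E) :=
  (IsGaussian.memLp_id (stdGaussian E) k (by simp)).integrable_norm_pow'

lemma integrable_stdGaussian_of_le_pow {f : E → ℝ} (hf : Continuous f) (C : ℝ) (k : ℕ)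
    (h : ∀ u, |f u| ≤ C * ‖u‖ ^ k) : Integrable f (stdGaussian E) :=
  ((integrable_norm_pow_stdGaussian k).const_mul C).mono' hf.aestronglyMeasurable
    (Filter.Eventually.of_forall h)

lemma integral_inner_pow_four_stdGaussian (y : E) :
    ∫ u, ⟪y, u⟫ ^ 4 ∂(stdGaussian E) = 3 * ‖y‖ ^ 4 := by
  have h := integral_pow_four_gaussianReal (‖y‖₊ ^ 2)
  rw [← map_inner_stdGaussian, integral_map (by fun_prop) (by fun_prop)] at h
  rw [h]; push_cast; ring

lemma integrable_inner_sq_mul_inner_sq_stdGaussian (x y : E) :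
    Integrable (fun u => ⟪x, u⟫ ^ 2 * ⟪y, u⟫ ^ 2) (stdGaussian E) := by
  refine integrable_stdGaussian_of_le_pow (by fun_prop) (‖x‖ ^ 2 * ‖y‖ ^ 2) 4 fun u => ?_
  rw [abs_mul, abs_pow, abs_pow]
  calc _ ≤ (‖x‖ * ‖u‖) ^ 2 * (‖y‖ * ‖u‖) ^ 2 := by
        gcongr <;> exact abs_real_inner_le_norm _ _
    _ = _ := by ring

lemma integral_inner_mul_inner_stdGaussian (x y : E) :
    ∫ u, ⟪x, u⟫ * ⟪y, u⟫ ∂(stdGaussian E) = ⟪x, y⟫ := by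
  have h := congrArg (fun B => B x y) (covarianceBilin_stdGaussian (E := E))
  rw [show ((innerSL ℝ : E →L[ℝ] E →L[ℝ] ℝ) x) y = ⟪x, y⟫ from rfl] at h
  rw [covarianceBilin_apply IsGaussian.memLp_two_id] at h
  simpa using h

/-- The fourth-order Gaussian moment identity `𝔼 ⟨x,u⟩² ⟨y,u⟩² = ‖x‖² ‖y‖² + 2 ⟨x,y⟩²`. -/
lemma integral_inner_sq_mul_inner_sq_stdGaussian (x y : E) :
    ∫ u, ⟪x, u⟫ ^ 2 * ⟪y, u⟫ ^ 2 ∂(stdGaussian E) = ‖x‖ ^ 2 * ‖y‖ ^ 2 + 2 * ⟪x, y⟫ ^ 2 := by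
  have i4 : ∀ z : E, Integrable (fun u => ⟪z, u⟫ ^ 4) (stdGaussian E) := fun z => by
    convert integrable_inner_sq_mul_inner_sq_stdGaussian z z using 2
    ring
  -- Polarization reduces the mixed moment to fourth moments of one-dimensional Gaussians.
  have e : ∀ u, ⟪x, u⟫ ^ 2 * ⟪y, u⟫ ^ 2 =
      (⟪x + y, u⟫ ^ 4 + ⟪x - y, u⟫ ^ 4 - 2 * ⟪x, u⟫ ^ 4 - 2 * ⟪y, u⟫ ^ 4) / 12 := by
    intro u
    rw [inner_add_left, inner_sub_left]; ring
  simp_rw [e]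
  rw [integral_div, integral_sub, integral_sub, integral_add, integral_const_mul,
    integral_const_mul]
  · simp only [integral_inner_pow_four_stdGaussian]
    have h1 := norm_add_sq_real x y
    have h2 := norm_sub_sq_real x y
    rw [show ‖x + y‖ ^ 4 = (‖x + y‖ ^ 2) ^ 2 by ring, show ‖x - y‖ ^ 4 = (‖x - y‖ ^ 2) ^ 2 by ring,
      h1, h2]
    ring
  · exact i4 _
  · exact i4 _
  · exact (i4 _).add (i4 _)
  · exact (i4 _).const_mul 2
  · exact ((i4 _).add (i4 _)).sub ((i4 _).const_mul 2)
  · exact (i4 _).const_mul 2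

end

/-! ### Integrating out an independent standard Gaussian direction -/

section

variable {Ω : Type*} [MeasurableSpace Ω] {P : Measure Ω} [IsProbabilityMeasure P]
  {E : Type*} [NormedAddCommGroup E] [InnerProductSpace ℝ E] [FiniteDimensional ℝ E]
  [MeasurableSpace E] [BorelSpace E]

/-- Fubini on the product law of `(Z, U)`. The bound `K z * ‖u‖ ^ k` suffices for integrability
because a Gaussian has moments of every order. -/
lemma integral_comp_indep_stdGaussian {S : Type*} [MeasurableSpace S] {Z : Ω → S} {U : Ω → E}
    (hZ : AEMeasurable Z P) (hU : HasLaw U (stdGaussian E) P) (hind : IndepFun Z U P)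
    {F : S → E → ℝ} (hF : Measurable fun p : S × E => F p.1 p.2) {K : S → ℝ} (hK : Measurable K)
    (hKi : Integrable (fun ω => K (Z ω)) P) (k : ℕ) (hFK : ∀ z u, |F z u| ≤ K z * ‖u‖ ^ k) :
    Integrable (fun ω => F (Z ω) (U ω)) P ∧
      ∫ ω, F (Z ω) (U ω) ∂P = ∫ ω, (∫ u, F (Z ω) u ∂(stdGaussian E)) ∂P := by
  have hmap : P.map (fun ω => (Z ω, U ω)) = (P.map Z).prod (stdGaussian E) := by
    rw [hind.map_prod_eq_prod_map_map hZ hU.aemeasurable, hU.map_eq]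
  have hpm : IsProbabilityMeasure (P.map Z) := Measure.isProbabilityMeasure_map hZ
  have hpair : AEMeasurable (fun ω => (Z ω, U ω)) P := hZ.prodMk hU.aemeasurable
  have hKν : Integrable K (P.map Z) :=
    (integrable_map_measure hK.aestronglyMeasurable hZ).2 hKi
  have hint : Integrable (fun p : S × E => F p.1 p.2) ((P.map Z).prod (stdGaussian E)) :=
    (hKν.mul_prod (integrable_norm_pow_stdGaussian k)).mono' hF.aestronglyMeasurable
      (Filter.Eventually.of_forall fun p => hFK p.1 p.2)
  constructor
  · rw [← hmap] at hint
    exact (integrable_map_measure hF.aestronglyMeasurable hpair).1 hint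
  · have h1 := integral_map hpair (f := fun p : S × E => F p.1 p.2) hF.aestronglyMeasurable
    rw [hmap, integral_prod _ hint] at h1
    rw [← h1, integral_map hZ]
    exact (hF.stronglyMeasurable.integral_prod_right (ν := stdGaussian E)).aestronglyMeasurable

variable {W U : Ω → E}

lemma memLp_inner_smul_stdGaussian (hW : MemLp W 2 P) (hU : HasLaw U (stdGaussian E) P)
    (hind : IndepFun W U P) : MemLp (fun ω => ⟪W ω, U ω⟫ • U ω) 2 P := by
  have hWm := hW.aestronglyMeasurable.aemeasurable
  have hUm := hU.aemeasurable
  rw [memLp_two_iff_integrable_sq_norm (by fun_prop)]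
  refine (integral_comp_indep_stdGaussian hWm hU hind (F := fun w u => ‖⟪w, u⟫ • u‖ ^ 2)
    (by fun_prop) (K := fun w => ‖w‖ ^ 2) (by fun_prop) ?_ 4 fun w u => ?_).1
  · exact (memLp_two_iff_integrable_sq_norm hW.aestronglyMeasurable).1 hW
  · rw [abs_of_nonneg (by positivity), norm_smul]
    calc _ ≤ ((‖w‖ * ‖u‖) * ‖u‖) ^ 2 := by
          gcongr; exact norm_inner_le_norm _ _
      _ = _ := by ring

lemma integral_sq_inner_mul_inner_stdGaussian (hW : MemLp W 2 P)
    (hU : HasLaw U (stdGaussian E) P) (hind : IndepFun W U P) (e : E) :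
    ∫ ω, (⟪W ω, U ω⟫ * ⟪e, U ω⟫) ^ 2 ∂P =
      ‖e‖ ^ 2 * ∫ ω, ‖W ω‖ ^ 2 ∂P + 2 * ∫ ω, ⟪e, W ω⟫ ^ 2 ∂P := by
  have hWm := hW.aestronglyMeasurable.aemeasurable
  have hW2 := (memLp_two_iff_integrable_sq_norm hW.aestronglyMeasurable).1 hW
  rw [(integral_comp_indep_stdGaussian hWm hU hind (F := fun w u => (⟪w, u⟫ * ⟪e, u⟫) ^ 2)
    (by fun_prop) (K := fun w => ‖w‖ ^ 2 * ‖e‖ ^ 2) (by fun_prop) (hW2.mul_const _) 4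
    fun w u => ?_).2]
  · simp_rw [mul_pow, integral_inner_sq_mul_inner_sq_stdGaussian]
    rw [integral_add (hW2.mul_const _), integral_mul_const, integral_const_mul]
    · simp_rw [real_inner_comm e]
      ring
    · simp_rw [real_inner_comm e]
      exact ((hW.const_inner e).integrable_sq).const_mul 2
  · rw [abs_of_nonneg (by positivity), ← sq_abs, abs_mul]
    calc _ ≤ ((‖w‖ * ‖u‖) * (‖e‖ * ‖u‖)) ^ 2 := by
          gcongr <;> exact abs_real_inner_le_norm _ _
      _ = _ := by ring

lemma integral_mul_inner_mul_inner_stdGaussian {X : Ω → ℝ} (hX : MemLp X 2 P) (hW : MemLp W 2 P)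
    (hU : HasLaw U (stdGaussian E) P) (hind : IndepFun (fun ω => (X ω, W ω)) U P) (e : E) :
    ∫ ω, X ω * (⟪W ω, U ω⟫ * ⟪e, U ω⟫) ∂P = ∫ ω, X ω * ⟪e, W ω⟫ ∂P := by
  have hm := hX.aestronglyMeasurable.aemeasurable.prodMk hW.aestronglyMeasurable.aemeasurable
  rw [(integral_comp_indep_stdGaussian hm hU hind
    (F := fun z u => z.1 * (⟪z.2, u⟫ * ⟪e, u⟫)) (by fun_prop)
    (K := fun z => ‖z.1‖ * ‖z.2‖ * ‖e‖) (by fun_prop)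
    ((hX.norm.integrable_mul hW.norm).mul_const _) 2 fun z u => ?_).2]
  · simp_rw [integral_const_mul, integral_inner_mul_inner_stdGaussian, real_inner_comm]
  · rw [abs_mul, abs_mul, ← Real.norm_eq_abs z.1]
    calc _ ≤ ‖z.1‖ * ((‖z.2‖ * ‖u‖) * (‖e‖ * ‖u‖)) := by
          gcongr <;> exact abs_real_inner_le_norm _ _
      _ = _ := by ring

end

/-! ### The iterates -/

section

variable {d : ℕ}

/-- The constant and the terms even in `u` cancel in the symmetric difference, so `μ` disappears
without any approximation. -/
lemma twoPointEstimator_quadModel (c : ℝ) (xstar : EuclideanSpace ℝ (Fin d)) {H : Matrix (Fin d) (Fin d) ℝ}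
    (hH : H.IsHermitian) {μ : ℝ} (hμ : μ ≠ 0) (u x : EuclideanSpace ℝ (Fin d)) :
    twoPointEstimator (quadModel c xstar H) μ u x =
      ⟪Matrix.toEuclideanCLM (𝕜 := ℝ) H (x - xstar), u⟫ • u := by
  set A := Matrix.toEuclideanCLM (n := Fin d) (𝕜 := ℝ) H with hA
  have hq : ∀ y, quadModel c xstar H y = c + 1 / 2 * ⟪A (y - xstar), y - xstar⟫ := fun y => by
    rw [quadModel]
    rfl
  have hsymm : ∀ v w : EuclideanSpace ℝ (Fin d), ⟪A v, w⟫ = ⟪A w, v⟫ := fun v w => by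
    have := Matrix.isSymmetric_toEuclideanLin_iff.2 hH v w
    exact this.trans (real_inner_comm _ _)
  rw [twoPointEstimator, hq, hq]
  congr 1
  rw [show x + μ • u - xstar = (x - xstar) + μ • u by abel,
    show x - μ • u - xstar = (x - xstar) - μ • u by abel]
  generalize x - xstar = y
  simp only [map_add, map_sub, map_smul, inner_add_left, inner_add_right, inner_sub_left,
    inner_sub_right, real_inner_smul_left, real_inner_smul_right]
  rw [hsymm u y]
  field_simp
  ring

lemma inner_eigenvectorBasis_toEuclideanCLM {H : Matrix (Fin d) (Fin d) ℝ} (hH : H.IsHermitian)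
    (i : Fin d) (v : EuclideanSpace ℝ (Fin d)) :
    ⟪hH.eigenvectorBasis i, Matrix.toEuclideanCLM (𝕜 := ℝ) H v⟫ =
      hH.eigenvalues i * ⟪hH.eigenvectorBasis i, v⟫ := by
  have h := Matrix.isSymmetric_toEuclideanLin_iff.2 hH (hH.eigenvectorBasis i) v
  have e : Matrix.toEuclideanLin H (hH.eigenvectorBasis i) =
      hH.eigenvalues i • hH.eigenvectorBasis i := by
    ext j
    exact congrFun (hH.mulVec_eigenvectorBasis i) j
  rw [e, real_inner_smul_left] at h
  exact h.symm

lemma norm_sq_eq_sum_inner_eigenvectorBasis {H : Matrix (Fin d) (Fin d) ℝ} (hH : H.IsHermitian)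
    (v : EuclideanSpace ℝ (Fin d)) : ‖v‖ ^ 2 = ∑ i, ⟪hH.eigenvectorBasis i, v⟫ ^ 2 :=
  (hH.eigenvectorBasis.sum_sq_inner_right v).symm

variable {f : EuclideanSpace ℝ (Fin d) → ℝ} {η β μ : ℝ} {x₀ : EuclideanSpace ℝ (Fin d)}

lemma state_congr {u v : ℕ → EuclideanSpace ℝ (Fin d)} {t : ℕ} (h : ∀ s < t, u s = v s) :
    state f η β μ x₀ u t = state f η β μ x₀ v t := by
  induction t with
  | zero => rfl
  | succ t ih => simp only [state, ih fun s hs => h s (hs.trans t.lt_succ_self), h t t.lt_succ_self]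

lemma measurable_state (hf : Measurable f) (t : ℕ) :
    Measurable fun u : ℕ → EuclideanSpace ℝ (Fin d) => state f η β μ x₀ u t := by
  induction t with
  | zero => exact measurable_const
  | succ t ih => simp only [state, twoPointEstimator]; fun_prop

variable {Ω : Type*} [MeasurableSpace Ω] {P : Measure Ω} {u : ℕ → Ω → EuclideanSpace ℝ (Fin d)}

lemma indepFun_state (hf : Measurable f) (hu : ∀ t, AEMeasurable (u t) P) (hind : iIndepFun u P)
    (t : ℕ) : IndepFun (fun ω => state f η β μ x₀ (fun s => u s ω) t) (u t) P := by
  have h := hind.indepFun_finset₀ (Finset.range t) {t} (by simp) hu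
  -- The state at time `t` only sees directions with index below `t`; padding the others with zero
  -- makes it a function of a finite tuple independent of `u t`.
  have hφ : Measurable fun v : Finset.range t → EuclideanSpace ℝ (Fin d) =>
      state f η β μ x₀ (fun s => if hs : s ∈ Finset.range t then v ⟨s, hs⟩ else 0) t := by
    refine (measurable_state hf t).comp (measurable_pi_lambda _ fun s => ?_)
    by_cases hs : s ∈ Finset.range t
    · simp only [hs, dite_true]; exact measurable_pi_apply _
    · simp only [hs, dite_false]; exact measurable_const
  have hψ : Measurable fun v : ({t} : Finset ℕ) → EuclideanSpace ℝ (Fin d) => v ⟨t, Finset.mem_singleton_self t⟩ :=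
    measurable_pi_apply _
  convert h.comp hφ hψ using 1
  · funext ω
    exact state_congr fun s hs => by simp [hs]
  · rfl

lemma measurable_quadModel (c : ℝ) (xstar : EuclideanSpace ℝ (Fin d)) (H : Matrix (Fin d) (Fin d) ℝ) :
    Measurable (quadModel c xstar H) := by
  have : quadModel c xstar H = fun y =>
      c + 1 / 2 * ⟪Matrix.toEuclideanCLM (n := Fin d) (𝕜 := ℝ) H (y - xstar), y - xstar⟫ := rfl
  rw [this]
  fun_prop

end

/-! ### Moments of the iterates -/

section

variable {d : ℕ} {Ω : Type*} [MeasurableSpace Ω] {P : Measure Ω} [IsProbabilityMeasure P]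
  {u : ℕ → Ω → EuclideanSpace ℝ (Fin d)} {c : ℝ} {xstar : EuclideanSpace ℝ (Fin d)}
  {H : Matrix (Fin d) (Fin d) ℝ} {η β μ : ℝ} {x₀ : EuclideanSpace ℝ (Fin d)}

/-- The deviation `x_t - x⋆` of the iterates on the quadratic model. -/
noncomputable def deviation (u : ℕ → Ω → EuclideanSpace ℝ (Fin d)) (c : ℝ) (xstar : EuclideanSpace ℝ (Fin d))
    (H : Matrix (Fin d) (Fin d) ℝ) (η β μ : ℝ) (x₀ : EuclideanSpace ℝ (Fin d)) (t : ℕ) (ω : Ω) :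
    EuclideanSpace ℝ (Fin d) :=
  iterate (quadModel c xstar H) η β μ x₀ u t ω - xstar

/-- The last displacement `η m_t` of the iterates on the quadratic model. -/
noncomputable def displacement (u : ℕ → Ω → EuclideanSpace ℝ (Fin d)) (c : ℝ)
    (xstar : EuclideanSpace ℝ (Fin d)) (H : Matrix (Fin d) (Fin d) ℝ) (η β μ : ℝ)
    (x₀ : EuclideanSpace ℝ (Fin d)) (t : ℕ) (ω : Ω) : EuclideanSpace ℝ (Fin d) :=
  η • (state (quadModel c xstar H) η β μ x₀ (fun s => u s ω) t).2

/-- The Hessian applied to the deviation. -/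
noncomputable def gradient (u : ℕ → Ω → EuclideanSpace ℝ (Fin d)) (c : ℝ) (xstar : EuclideanSpace ℝ (Fin d))
    (H : Matrix (Fin d) (Fin d) ℝ) (η β μ : ℝ) (x₀ : EuclideanSpace ℝ (Fin d)) (t : ℕ) (ω : Ω) :
    EuclideanSpace ℝ (Fin d) :=
  Matrix.toEuclideanCLM (𝕜 := ℝ) H (deviation u c xstar H η β μ x₀ t ω)

local notation "θ" => deviation u c xstar H η β μ x₀
local notation "δ" => displacement u c xstar H η β μ x₀
local notation "γ" => gradient u c xstar H η β μ x₀

omit [MeasurableSpace Ω] in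
lemma displacement_succ (hH : H.IsHermitian) (hμ : μ ≠ 0) (t : ℕ) (ω : Ω) :
    δ (t + 1) ω = β • δ t ω + η • (⟪γ t ω, u t ω⟫ • u t ω) := by
  simp only [displacement, state, twoPointEstimator_quadModel c xstar hH hμ, gradient, deviation,
    iterate, smul_add, smul_comm η β]

omit [MeasurableSpace Ω] in
lemma deviation_succ (t : ℕ) (ω : Ω) : θ (t + 1) ω = θ t ω - δ (t + 1) ω := by
  simp only [deviation, displacement, iterate, state]
  abel

omit [IsProbabilityMeasure P] in
lemma indepFun_deviation_displacement (hu_indep : iIndepFun u P) (hu : ∀ t, AEMeasurable (u t) P)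
    (t : ℕ) : IndepFun (fun ω => (θ t ω, δ t ω)) (u t) P :=
  (indepFun_state (f := quadModel c xstar H) (η := η) (β := β) (μ := μ) (x₀ := x₀)
    (measurable_quadModel c xstar H) hu hu_indep t).comp
    (φ := fun z : EuclideanSpace ℝ (Fin d) × EuclideanSpace ℝ (Fin d) => (z.1 - xstar, η • z.2))
    (by fun_prop) measurable_id

variable (hu_indep : iIndepFun u P)
  (hu_law : ∀ t, HasLaw (u t) (stdGaussian (EuclideanSpace ℝ (Fin d))) P)
include hu_indep hu_law

lemma memLp_deviation_displacement (hH : H.IsHermitian) (hμ : μ ≠ 0) (t : ℕ) :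
    MemLp (θ t) 2 P ∧ MemLp (δ t) 2 P := by
  induction t with
  | zero =>
    refine ⟨memLp_const (x₀ - xstar), ?_⟩
    have : δ 0 = fun _ => (0 : EuclideanSpace ℝ (Fin d)) := by
      funext ω; simp [displacement, state]
    rw [this]
    exact memLp_const 0
  | succ t ih =>
    have hg : MemLp (γ t) 2 P :=
      ih.1.continuousLinearMap_comp (Matrix.toEuclideanCLM (n := Fin d) (𝕜 := ℝ) H)
    have hi : IndepFun (γ t) (u t) P :=
      (indepFun_deviation_displacement hu_indep (fun t => (hu_law t).aemeasurable) t).comp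
        (φ := fun z : EuclideanSpace ℝ (Fin d) × EuclideanSpace ℝ (Fin d) =>
          Matrix.toEuclideanCLM (n := Fin d) (𝕜 := ℝ) H z.1) (by fun_prop) measurable_id
    have hδ : MemLp (δ (t + 1)) 2 P := by
      rw [funext (displacement_succ hH hμ t)]
      exact (ih.2.const_smul β).add ((memLp_inner_smul_stdGaussian hg (hu_law t) hi).const_smul η)
    refine ⟨?_, hδ⟩
    rw [funext (deviation_succ t)]
    exact ih.1.sub hδ

lemma meanRecursion (hH : H.IsHermitian) (hμ : μ ≠ 0) (i : Fin d) :
    MeanRecursion β (η * hH.eigenvalues i)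
      (fun t => ∫ ω, ⟪hH.eigenvectorBasis i, θ t ω⟫ ∂P)
      (fun t => ∫ ω, ⟪hH.eigenvectorBasis i, δ t ω⟫ ∂P) := by
  set e := hH.eigenvectorBasis i
  have hL := fun t => memLp_deviation_displacement (c := c) (xstar := xstar) (η := η) (β := β)
    (x₀ := x₀) hu_indep hu_law hH hμ t
  have hθ : ∀ t, Integrable (fun ω => ⟪e, θ t ω⟫) P := fun t =>
    ((hL t).1.const_inner (𝕜 := ℝ) e).integrable one_le_two
  have hδ : ∀ t, Integrable (fun ω => ⟪e, δ t ω⟫) P := fun t =>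
    ((hL t).2.const_inner (𝕜 := ℝ) e).integrable one_le_two
  refine ⟨by simp [displacement, state], fun t => ?_, fun t => ?_⟩
  · have hg : MemLp (γ t) 2 P :=
      (hL t).1.continuousLinearMap_comp (Matrix.toEuclideanCLM (n := Fin d) (𝕜 := ℝ) H)
    -- The first moment is the cross-moment identity with the scalar factor taken constant.
    have hi : IndepFun (fun ω => ((1 : ℝ), γ t ω)) (u t) P :=
      (indepFun_deviation_displacement hu_indep (fun t => (hu_law t).aemeasurable) t).comp
        (φ := fun z : EuclideanSpace ℝ (Fin d) × EuclideanSpace ℝ (Fin d) =>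
          ((1 : ℝ), Matrix.toEuclideanCLM (n := Fin d) (𝕜 := ℝ) H z.1)) (by fun_prop)
          measurable_id
    have hE := integral_mul_inner_mul_inner_stdGaussian (memLp_const 1) hg (hu_law t) hi e
    have hgi : Integrable (fun ω => ⟪γ t ω, u t ω⟫ * ⟪e, u t ω⟫) P := by
      have := ((memLp_inner_smul_stdGaussian hg (hu_law t)
        (hi.comp (φ := Prod.snd) (by fun_prop) measurable_id)).const_inner (𝕜 := ℝ) e).integrable one_le_two
      simpa only [real_inner_smul_right] using this
    simp only [one_mul] at hE
    simp only [displacement_succ hH hμ, inner_add_right, real_inner_smul_right]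
    rw [integral_add ((hδ t).const_mul β) (hgi.const_mul η), integral_const_mul,
      integral_const_mul, hE]
    simp only [gradient, e, inner_eigenvectorBasis_toEuclideanCLM]
    rw [integral_const_mul]
    ring
  · simp only [deviation_succ, inner_sub_right]
    exact integral_sub (hθ t) (hδ (t + 1))

lemma momentRecursion (hH : H.IsHermitian) (hμ : μ ≠ 0) :
    MomentRecursion β (fun i => η * hH.eigenvalues i)
      (fun t i => ∫ ω, ⟪hH.eigenvectorBasis i, θ t ω⟫ ^ 2 ∂P)
      (fun t i => ∫ ω, ⟪hH.eigenvectorBasis i, θ t ω⟫ * ⟪hH.eigenvectorBasis i, δ t ω⟫ ∂P)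
      (fun t i => ∫ ω, ⟪hH.eigenvectorBasis i, δ t ω⟫ ^ 2 ∂P) := by
  have hL := fun t => memLp_deviation_displacement (c := c) (xstar := xstar) (η := η) (β := β)
    (x₀ := x₀) hu_indep hu_law hH hμ t
  have hp : ∀ t i, MemLp (fun ω => ⟪hH.eigenvectorBasis i, θ t ω⟫) 2 P := fun t i =>
    (hL t).1.const_inner (𝕜 := ℝ) _
  have hq : ∀ t i, MemLp (fun ω => ⟪hH.eigenvectorBasis i, δ t ω⟫) 2 P := fun t i =>
    (hL t).2.const_inner (𝕜 := ℝ) _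
  have hg : ∀ t, MemLp (γ t) 2 P := fun t =>
    (hL t).1.continuousLinearMap_comp (Matrix.toEuclideanCLM (n := Fin d) (𝕜 := ℝ) H)
  have hind := fun t => indepFun_deviation_displacement (c := c) (xstar := xstar) (H := H)
    (η := η) (β := β) (μ := μ) (x₀ := x₀) hu_indep (fun t => (hu_law t).aemeasurable) t
  have hgi : ∀ t, IndepFun (γ t) (u t) P := fun t => (hind t).comp
    (φ := fun z : EuclideanSpace ℝ (Fin d) × EuclideanSpace ℝ (Fin d) =>
      Matrix.toEuclideanCLM (n := Fin d) (𝕜 := ℝ) H z.1) (by fun_prop) measurable_id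
  have hs : ∀ t i, MemLp (fun ω => ⟪γ t ω, u t ω⟫ * ⟪hH.eigenvectorBasis i, u t ω⟫) 2 P :=
    fun t i => by
      have := (memLp_inner_smul_stdGaussian (hg t) (hu_law t) (hgi t)).const_inner (𝕜 := ℝ)
        (hH.eigenvectorBasis i)
      simpa only [real_inner_smul_right] using this
  have hγ : ∀ t i ω, ⟪hH.eigenvectorBasis i, γ t ω⟫ =
      hH.eigenvalues i * ⟪hH.eigenvectorBasis i, θ t ω⟫ := fun t i ω =>
    inner_eigenvectorBasis_toEuclideanCLM hH i _
  -- the cross moments with the stochastic gradient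
  have hps : ∀ t i, ∫ ω, ⟪hH.eigenvectorBasis i, θ t ω⟫ *
      (⟪γ t ω, u t ω⟫ * ⟪hH.eigenvectorBasis i, u t ω⟫) ∂P =
      hH.eigenvalues i * ∫ ω, ⟪hH.eigenvectorBasis i, θ t ω⟫ ^ 2 ∂P := by
    intro t i
    rw [integral_mul_inner_mul_inner_stdGaussian (hp t i) (hg t) (hu_law t)
      ((hind t).comp (φ := fun z : EuclideanSpace ℝ (Fin d) × EuclideanSpace ℝ (Fin d) =>
        (⟪hH.eigenvectorBasis i, z.1⟫, Matrix.toEuclideanCLM (n := Fin d) (𝕜 := ℝ) H z.1))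
        (by fun_prop) measurable_id), ← integral_const_mul]
    congr 1 with ω
    rw [hγ]; ring
  have hqs : ∀ t i, ∫ ω, ⟪hH.eigenvectorBasis i, δ t ω⟫ *
      (⟪γ t ω, u t ω⟫ * ⟪hH.eigenvectorBasis i, u t ω⟫) ∂P =
      hH.eigenvalues i *
        ∫ ω, ⟪hH.eigenvectorBasis i, θ t ω⟫ * ⟪hH.eigenvectorBasis i, δ t ω⟫ ∂P := by
    intro t i
    rw [integral_mul_inner_mul_inner_stdGaussian (hq t i) (hg t) (hu_law t)
      ((hind t).comp (φ := fun z : EuclideanSpace ℝ (Fin d) × EuclideanSpace ℝ (Fin d) =>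
        (⟪hH.eigenvectorBasis i, z.2⟫, Matrix.toEuclideanCLM (n := Fin d) (𝕜 := ℝ) H z.1))
        (by fun_prop) measurable_id), ← integral_const_mul]
    congr 1 with ω
    rw [hγ]; ring
  -- The sum over `j` is `𝔼 ‖γ‖²` by Parseval; this is the only place where modes mix.
  have hss : ∀ t i, ∫ ω, (⟪γ t ω, u t ω⟫ * ⟪hH.eigenvectorBasis i, u t ω⟫) ^ 2 ∂P =
      ∑ j, hH.eigenvalues j ^ 2 * ∫ ω, ⟪hH.eigenvectorBasis j, θ t ω⟫ ^ 2 ∂P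
        + 2 * hH.eigenvalues i ^ 2 * ∫ ω, ⟪hH.eigenvectorBasis i, θ t ω⟫ ^ 2 ∂P := by
    intro t i
    rw [integral_sq_inner_mul_inner_stdGaussian (hg t) (hu_law t) (hgi t)]
    simp_rw [norm_sq_eq_sum_inner_eigenvectorBasis hH (γ t _), hγ, mul_pow]
    rw [integral_finsetSum _ fun j _ => ((hp t j).integrable_sq).const_mul _]
    simp_rw [integral_const_mul]
    rw [hH.eigenvectorBasis.orthonormal.1 i]
    ring
  have hδ : ∀ t i ω, ⟪hH.eigenvectorBasis i, δ (t + 1) ω⟫ = β * ⟪hH.eigenvectorBasis i, δ t ω⟫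
      + η * (⟪γ t ω, u t ω⟫ * ⟪hH.eigenvectorBasis i, u t ω⟫) := fun t i ω => by
    rw [displacement_succ hH hμ, inner_add_right, real_inner_smul_right, real_inner_smul_right,
      real_inner_smul_right]
  have hpq : ∀ t i, ∫ ω, ⟪hH.eigenvectorBasis i, θ t ω⟫ * ⟪hH.eigenvectorBasis i, δ (t + 1) ω⟫ ∂P
      = β * ∫ ω, ⟪hH.eigenvectorBasis i, θ t ω⟫ * ⟪hH.eigenvectorBasis i, δ t ω⟫ ∂P
        + η * hH.eigenvalues i * ∫ ω, ⟪hH.eigenvectorBasis i, θ t ω⟫ ^ 2 ∂P := by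
    intro t i
    rw [mul_assoc, ← hps, ← integral_const_mul, ← integral_const_mul, ← integral_add]
    · congr 1 with ω
      rw [hδ]; ring
    · exact ((hp t i).integrable_mul (hq t i)).const_mul β
    · exact ((hp t i).integrable_mul (hs t i)).const_mul η
  refine ⟨fun t i x y => ?_, fun i => by simp [displacement, state],
    fun i => by simp [displacement, state], fun t i => ?_, fun t i => ?_, fun t i => ?_⟩
  · rw [← integral_const_mul, ← integral_const_mul, ← integral_const_mul, ← integral_add,
      ← integral_add]
    · refine integral_nonneg fun ω => ?_
      refine (sq_nonneg (x * ⟪hH.eigenvectorBasis i, θ t ω⟫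
        + y * ⟪hH.eigenvectorBasis i, δ t ω⟫)).trans_eq ?_
      ring
    · exact ((hp t i).integrable_sq.const_mul _).add
        (((hp t i).integrable_mul (hq t i)).const_mul _)
    · exact (hq t i).integrable_sq.const_mul _
    · exact (hp t i).integrable_sq.const_mul _
    · exact ((hp t i).integrable_mul (hq t i)).const_mul _
  · have e : ∀ ω, ⟪hH.eigenvectorBasis i, δ (t + 1) ω⟫ ^ 2 =
        β ^ 2 * ⟪hH.eigenvectorBasis i, δ t ω⟫ ^ 2
        + 2 * β * η * (⟪hH.eigenvectorBasis i, δ t ω⟫ *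
          (⟪γ t ω, u t ω⟫ * ⟪hH.eigenvectorBasis i, u t ω⟫))
        + η ^ 2 * (⟪γ t ω, u t ω⟫ * ⟪hH.eigenvectorBasis i, u t ω⟫) ^ 2 := fun ω => by
      rw [hδ]; ring
    simp_rw [e]
    have i1 := (hq t i).integrable_sq.const_mul (β ^ 2)
    have i2 := ((hq t i).integrable_mul (hs t i)).const_mul (2 * β * η)
    have i3 := (hs t i).integrable_sq.const_mul (η ^ 2)
    have e1 := integral_add (i1.add i2) i3
    have e2 := integral_add i1 i2
    simp only [Pi.add_apply, Pi.mul_apply] at e1 e2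
    rw [e1, e2, integral_const_mul, integral_const_mul, integral_const_mul, hqs, hss, mul_add,
      Finset.mul_sum]
    simp_rw [mul_pow, mul_assoc]
    ring
  · have e1 := integral_sub ((hp t i).integrable_mul (hq (t + 1) i)) (hq (t + 1) i).integrable_sq
    simp only [Pi.mul_apply] at e1
    rw [← hpq, ← e1]
    congr 1 with ω
    rw [deviation_succ, inner_sub_right]
    ring
  · have e : ∀ ω, ⟪hH.eigenvectorBasis i, θ (t + 1) ω⟫ ^ 2 =
        ⟪hH.eigenvectorBasis i, θ t ω⟫ ^ 2
        - 2 * (⟪hH.eigenvectorBasis i, θ t ω⟫ * ⟪hH.eigenvectorBasis i, δ (t + 1) ω⟫)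
        + ⟪hH.eigenvectorBasis i, δ (t + 1) ω⟫ ^ 2 := fun ω => by
      rw [deviation_succ, inner_sub_right]; ring
    simp_rw [e]
    have i1 := (hp t i).integrable_sq
    have i2 := ((hp t i).integrable_mul (hq (t + 1) i)).const_mul 2
    have e1 := integral_add (i1.sub i2) (hq (t + 1) i).integrable_sq
    have e2 := integral_sub i1 i2
    simp only [Pi.sub_apply, Pi.mul_apply] at e1 e2
    rw [e1, e2, integral_const_mul, hpq]

end

/-! ### Stability in terms of the eigenvalues -/

section

variable {d : ℕ} {Ω : Type*} [MeasurableSpace Ω] {P : Measure Ω} [IsProbabilityMeasure P]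
  {u : ℕ → Ω → EuclideanSpace ℝ (Fin d)} {c : ℝ} {xstar : EuclideanSpace ℝ (Fin d)}
  {H : Matrix (Fin d) (Fin d) ℝ} {η β μ : ℝ}
  (hu_indep : iIndepFun u P)
  (hu_law : ∀ t, HasLaw (u t) (stdGaussian (EuclideanSpace ℝ (Fin d))) P)
  (hH : H.IsHermitian) (hμ : μ ≠ 0) (hβ0 : 0 ≤ β)
include hu_indep hu_law hH hμ hβ0

lemma stableInMean_of_lt (hβ1 : β < 1) (h0 : ∀ i, 0 ≤ η * hH.eigenvalues i)
    (h : ∀ i, η * hH.eigenvalues i < 2 * (1 + β)) :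
    StableInMean P xstar (fun x₀ => iterate (quadModel c xstar H) η β μ x₀ u) := by
  intro x₀
  have hint : ∀ t, Integrable (deviation u c xstar H η β μ x₀ t) P := fun t =>
    (memLp_deviation_displacement hu_indep hu_law hH hμ t).1.integrable one_le_two
  refine ⟨hint, ?_⟩
  choose C hC using fun i => (meanRecursion (c := c) (xstar := xstar) (η := η) (β := β) (x₀ := x₀)
    hu_indep hu_law hH hμ i).bounded hβ0 hβ1 (h0 i) (h i)
  refine ⟨√(∑ i, C i), ?_⟩
  rintro _ ⟨t, rfl⟩
  refine Real.le_sqrt_of_sq_le ?_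
  rw [norm_sq_eq_sum_inner_eigenvectorBasis hH]
  refine Finset.sum_le_sum fun i _ => ?_
  have := hC i t
  rwa [integral_inner (hint t)] at this

lemma not_stableInMean_of_gt {i : Fin d} (h : 2 * (1 + β) < η * hH.eigenvalues i) :
    ¬ StableInMean P xstar (fun x₀ => iterate (quadModel c xstar H) η β μ x₀ u) := by
  intro hs
  set e := hH.eigenvectorBasis i with he
  have he1 : ‖e‖ = 1 := hH.eigenvectorBasis.orthonormal.1 i
  -- Starting one unit eigenvector away from `x⋆` gives mode `i` initial mean one.
  obtain ⟨hint, C, hC⟩ := hs (xstar + e)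
  refine (meanRecursion (c := c) (xstar := xstar) (η := η) (β := β) (x₀ := xstar + e)
    hu_indep hu_law hH hμ i).not_bounded hβ0 h ?_ ⟨C, fun t => ?_⟩
  · simp [deviation, iterate, state, ← he, he1]
  · rw [← he, integral_inner (f := deviation u c xstar H η β μ (xstar + e) t) (hint t)]
    refine (abs_real_inner_le_norm _ _).trans ?_
    rw [he1, one_mul]
    exact hC ⟨t, rfl⟩

lemma stableInMeanSquare_of_sum_lt (hβ1 : β < 1) (h0 : ∀ i, 0 ≤ η * hH.eigenvalues i)
    (h : ∀ i, η * hH.eigenvalues i < 1 - β ^ 2)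
    (hφ : ∑ i, (1 + β) * (η * hH.eigenvalues i) / (2 * (1 - β ^ 2 - η * hH.eigenvalues i)) < 1) :
    StableInMeanSquare P xstar (fun x₀ => iterate (quadModel c xstar H) η β μ x₀ u) := by
  intro x₀
  have hL : ∀ t, MemLp (deviation u c xstar H η β μ x₀ t) 2 P := fun t =>
    (memLp_deviation_displacement hu_indep hu_law hH hμ t).1
  refine ⟨fun t => (memLp_two_iff_integrable_sq_norm (hL t).aestronglyMeasurable).1 (hL t), ?_⟩
  choose C hC using fun i => (momentRecursion (c := c) (xstar := xstar) (η := η) (β := β)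
    (x₀ := x₀) hu_indep hu_law hH hμ).bounded hβ0 hβ1 h0 h hφ i
  refine ⟨∑ i, C i, ?_⟩
  rintro _ ⟨t, rfl⟩
  change ∫ ω, ‖deviation u c xstar H η β μ x₀ t ω‖ ^ 2 ∂P ≤ _
  simp_rw [norm_sq_eq_sum_inner_eigenvectorBasis hH]
  rw [integral_finsetSum _ fun i _ => ((hL t).const_inner (𝕜 := ℝ) _).integrable_sq]
  exact Finset.sum_le_sum fun i _ => hC i t

/-- Mode `i` is a top mode. Either it has reached `1 - β²` and is unstable by itself, or every mode
lies below and the total sum exceeding one causes the instability. -/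
lemma not_stableInMeanSquare {i : Fin d} (hβ1 : β < 1) (h0 : ∀ i, 0 ≤ η * hH.eigenvalues i)
    (hi : 0 < η * hH.eigenvalues i) (hmax : ∀ j, η * hH.eigenvalues j ≤ η * hH.eigenvalues i)
    (h : η * hH.eigenvalues i < 1 - β ^ 2 →
      1 < ∑ i, (1 + β) * (η * hH.eigenvalues i) / (2 * (1 - β ^ 2 - η * hH.eigenvalues i))) :
    ¬ StableInMeanSquare P xstar (fun x₀ => iterate (quadModel c xstar H) η β μ x₀ u) := by
  intro hs
  set e := hH.eigenvectorBasis i with he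
  have he1 : ‖e‖ = 1 := hH.eigenvectorBasis.orthonormal.1 i
  obtain ⟨hint, C, hC⟩ := hs (xstar + e)
  have hrec := momentRecursion (c := c) (xstar := xstar) (η := η) (β := β) (x₀ := xstar + e)
    hu_indep hu_law hH hμ
  have ha : 0 < ∫ ω, ⟪hH.eigenvectorBasis i, deviation u c xstar H η β μ (xstar + e) 0 ω⟫ ^ 2 ∂P := by
    simp [deviation, iterate, state, ← he, he1]
  have hb : ∀ j, ∃ C, ∀ t,
      ∫ ω, ⟪hH.eigenvectorBasis j, deviation u c xstar H η β μ (xstar + e) t ω⟫ ^ 2 ∂P ≤ C := by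
    refine fun j => ⟨C, fun t => le_trans ?_ (hC ⟨t, rfl⟩)⟩
    refine integral_mono_of_nonneg (Filter.Eventually.of_forall fun ω => sq_nonneg _) (hint t)
      (Filter.Eventually.of_forall fun ω => ?_)
    have := abs_real_inner_le_norm (hH.eigenvectorBasis j)
      (deviation u c xstar H η β μ (xstar + e) t ω)
    rw [hH.eigenvectorBasis.orthonormal.1 j, one_mul] at this
    exact sq_le_sq' (abs_le.1 this).1 (abs_le.1 this).2
  rcases lt_or_ge (η * hH.eigenvalues i) (1 - β ^ 2) with hlt | hge
  · exact hrec.not_bounded_of_one_lt hβ0 hβ1 h0 (fun j => (hmax j).trans_lt hlt) (h hlt) hi ha hb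
  · exact hrec.not_bounded_of_le hβ0 hβ1 hge ha hb

end

/-! ### The critical equation -/

section

variable {ι : Type*} [Fintype ι] {β : ℝ} {l : ι → ℝ} {i₀ : ι}

lemma critical_term_eq (hβ0 : 0 ≤ β) (hβ1 : β < 1) {κ : ℝ} (hκ : κ < 1 - β ^ 2) :
    κ / (2 * (1 - β) * (1 - κ / (1 - β ^ 2))) = (1 + β) * κ / (2 * (1 - β ^ 2 - κ)) := by
  have h1 : 1 - β ^ 2 ≠ 0 := by nlinarith
  have h2 : 1 - β ≠ 0 := by linarith
  have h3 : 1 - β ^ 2 - κ ≠ 0 := by linarith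
  have h4 : 1 - κ / (1 - β ^ 2) = (1 - β ^ 2 - κ) / (1 - β ^ 2) := by field_simp
  rw [h4]
  field_simp
  ring

/-- The total noise amplification of the step size `η`. -/
noncomputable def criticalSum (β : ℝ) (l : ι → ℝ) (η : ℝ) : ℝ :=
  ∑ i, (1 + β) * (η * l i) / (2 * (1 - β ^ 2 - η * l i))

lemma criticalSum_lt_criticalSum (hβ0 : 0 ≤ β) (hl : ∀ i, 0 ≤ l i)
    (hmax : ∀ i, l i ≤ l i₀) (hpos : 0 < l i₀) {η₁ η₂ : ℝ} (h0 : 0 < η₁) (h12 : η₁ < η₂)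
    (h2 : η₂ * l i₀ < 1 - β ^ 2) : criticalSum β l η₁ < criticalSum β l η₂ := by
  have key : ∀ i, η₁ * l i ≤ η₂ * l i := fun i => mul_le_mul_of_nonneg_right h12.le (hl i)
  have hs : ∀ i, η₂ * l i < 1 - β ^ 2 := fun i =>
    (mul_le_mul_of_nonneg_left (hmax i) (h0.trans h12).le).trans_lt h2
  have hβ : 0 < 1 + β := by linarith
  refine Finset.sum_lt_sum (fun i _ => ?_) ⟨i₀, Finset.mem_univ _, ?_⟩
  · have := mul_nonneg h0.le (hl i)
    exact div_le_div₀ (mul_nonneg hβ.le (this.trans (key i)))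
      (mul_le_mul_of_nonneg_left (key i) hβ.le) (by linarith [hs i]) (by linarith [key i])
  · have := mul_lt_mul_of_pos_right h12 hpos
    exact div_lt_div₀ (mul_lt_mul_of_pos_left this hβ) (by linarith)
      (mul_nonneg hβ.le (mul_nonneg (h0.trans h12).le hpos.le)) (by linarith [hs i₀])

lemma continuousOn_criticalSum {B : ℝ} (hmax : ∀ i, l i ≤ l i₀)
    (hB : B * l i₀ < 1 - β ^ 2) (hl0 : 0 ≤ l i₀) : ContinuousOn (criticalSum β l) (Set.Icc 0 B) := by
  unfold criticalSum
  refine continuousOn_finsetSum _ fun i _ => ContinuousOn.div (by fun_prop) (by fun_prop) ?_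
  intro η hη
  have h1 : η * l i ≤ η * l i₀ := mul_le_mul_of_nonneg_left (hmax i) hη.1
  have h2 : η * l i₀ ≤ B * l i₀ := mul_le_mul_of_nonneg_right hη.2 hl0
  have : 0 < 2 * (1 - β ^ 2 - η * l i) := by linarith
  exact this.ne'

lemma exists_criticalSum_eq_one (hβ0 : 0 ≤ β) (hβ1 : β < 1) (hl : ∀ i, 0 ≤ l i)
    (hmax : ∀ i, l i ≤ l i₀) (hpos : 0 < l i₀) :
    ∃ η, 0 < η ∧ η * l i₀ < 1 - β ^ 2 ∧ criticalSum β l η = 1 ∧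
      2 * (1 - β) / (∑ i, l i + 2 * l i₀ / (1 + β)) ≤ η ∧ η ≤ 2 * (1 - β) / ∑ i, l i := by
  have hβ : 0 < 1 + β := by linarith
  have hβ' : 0 < 1 - β := by linarith
  have hs : 0 < 1 - β ^ 2 := by nlinarith
  have hT : l i₀ ≤ ∑ i, l i := Finset.single_le_sum (fun i _ => hl i) (Finset.mem_univ i₀)
  set T := ∑ i, l i with hTd
  have hTpos : 0 < T := hpos.trans_le hT
  have hD : 0 < (1 + β) * T + 2 * l i₀ := by positivity
  -- Root of the equation obtained by replacing every denominator with the smallest one, that of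
  -- `i₀`; there the true sum is at most one.
  set lo := 2 * (1 - β ^ 2) / ((1 + β) * T + 2 * l i₀) with hlo
  have hlo_eq : 2 * (1 - β) / (T + 2 * l i₀ / (1 + β)) = lo := by
    rw [hlo]; field_simp; ring
  -- Root of the equation keeping only the term `i₀`; there the true sum is at least one. It lies
  -- before the pole since `2 / (3 + β) < 1`.
  set hi := 2 * (1 - β ^ 2) / ((3 + β) * l i₀) with hhi
  have hlo0 : 0 < lo := by positivity
  have hlohi : lo ≤ hi := by
    refine div_le_div_of_nonneg_left (by positivity) (by positivity) ?_
    nlinarith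
  have hhi_l : hi * l i₀ * (3 + β) = 2 * (1 - β ^ 2) := by rw [hhi]; field_simp
  have hhi_lt : hi * l i₀ < 1 - β ^ 2 := by
    have : 0 < hi * l i₀ := mul_pos (hlo0.trans_le hlohi) hpos
    nlinarith
  have hlo_lt : lo * l i₀ < 1 - β ^ 2 :=
    (mul_le_mul_of_nonneg_right hlohi hpos.le).trans_lt hhi_lt
  have h_lo : criticalSum β l lo ≤ 1 := by
    have h1 : criticalSum β l lo ≤ ∑ i, (1 + β) * (lo * l i) / (2 * (1 - β ^ 2 - lo * l i₀)) := by
      refine Finset.sum_le_sum fun i _ => ?_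
      have := mul_le_mul_of_nonneg_left (hmax i) hlo0.le
      have := mul_nonneg hlo0.le (hl i)
      exact div_le_div_of_nonneg_left (by positivity) (by linarith) (by linarith)
    refine h1.trans ?_
    rw [← Finset.sum_div, ← Finset.mul_sum, ← Finset.mul_sum, ← hTd, div_le_one (by linarith)]
    have : lo * ((1 + β) * T + 2 * l i₀) = 2 * (1 - β ^ 2) := by rw [hlo]; field_simp
    linarith
  have h_hi : 1 ≤ criticalSum β l hi := by
    have h1 : (1 + β) * (hi * l i₀) / (2 * (1 - β ^ 2 - hi * l i₀)) = 1 := by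
      rw [div_eq_one_iff_eq (by linarith)]
      linarith
    rw [← h1]
    refine Finset.single_le_sum
      (f := fun i => (1 + β) * (hi * l i) / (2 * (1 - β ^ 2 - hi * l i))) (fun i _ => ?_)
      (Finset.mem_univ i₀)
    have h2 := mul_le_mul_of_nonneg_left (hmax i) (hlo0.le.trans hlohi)
    have h3 := mul_nonneg (hlo0.le.trans hlohi) (hl i)
    exact div_nonneg (by positivity) (by linarith)
  obtain ⟨η, ⟨h1, h2⟩, h3⟩ := intermediate_value_Icc hlohi
    ((continuousOn_criticalSum hmax hhi_lt hpos.le).mono (Set.Icc_subset_Icc_left hlo0.le))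
    ⟨h_lo, h_hi⟩
  have hη0 : 0 < η := hlo0.trans_le h1
  have hη_lt : η * l i₀ < 1 - β ^ 2 := (mul_le_mul_of_nonneg_right h2 hpos.le).trans_lt hhi_lt
  refine ⟨η, hη0, hη_lt, h3, hlo_eq ▸ h1, ?_⟩
  rw [le_div_iff₀ hTpos]
  -- Enlarging every denominator to `2 (1 - β²)` yields the trace upper bound.
  have h4 : ∑ i, (1 + β) * (η * l i) / (2 * (1 - β ^ 2)) ≤ 1 := by
    refine le_trans ?_ h3.le
    refine Finset.sum_le_sum fun i _ => ?_
    have h5 := mul_le_mul_of_nonneg_left (hmax i) hη0.le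
    have h6 := mul_nonneg hη0.le (hl i)
    exact div_le_div_of_nonneg_left (by positivity) (by linarith) (by linarith)
  rw [← Finset.sum_div, ← Finset.mul_sum, ← Finset.mul_sum, ← hTd, div_le_one (by linarith)] at h4
  refine le_of_mul_le_mul_left ?_ hβ
  linarith

end

lemma exists_eigenvalue_eq_lambdaMax {d : ℕ} {H : Matrix (Fin d) (Fin d) ℝ} (hH : H.PosSemidef)
    (hH0 : H ≠ 0) : ∃ i, hH.isHermitian.eigenvalues i = lambdaMax hH.isHermitian ∧
      (∀ j, hH.isHermitian.eigenvalues j ≤ hH.isHermitian.eigenvalues i) ∧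
      0 < hH.isHermitian.eigenvalues i := by
  have hne : ∃ j, hH.isHermitian.eigenvalues j ≠ 0 := by
    by_contra! h
    exact hH0 (hH.isHermitian.eigenvalues_eq_zero_iff.1 (funext h))
  obtain ⟨j, hj⟩ := hne
  have : Nonempty (Fin d) := ⟨j⟩
  obtain ⟨i, hi⟩ := exists_eq_ciSup_of_finite (f := hH.isHermitian.eigenvalues)
  have hle : ∀ k, hH.isHermitian.eigenvalues k ≤ hH.isHermitian.eigenvalues i := fun k => by
    rw [hi]; exact le_ciSup (Set.finite_range _).bddAbove k
  exact ⟨i, hi, hle, ((hH.eigenvalues_nonneg j).lt_of_ne' hj).trans_le (hle j)⟩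

end ZOGDM

/-! ### Assembly of the critical step sizes -/

theorem mainTheorem1 {d : ℕ} {Ω : Type*} [MeasurableSpace Ω] (P : Measure Ω)
    [IsProbabilityMeasure P]
    (u : ℕ → Ω → EuclideanSpace ℝ (Fin d))
    (hu_indep : iIndepFun u P)
    (hu_law : ∀ t, HasLaw (u t) (stdGaussian (EuclideanSpace ℝ (Fin d))) P)
    (c : ℝ) (xstar : EuclideanSpace ℝ (Fin d))
    (H : Matrix (Fin d) (Fin d) ℝ) (hH : H.PosSemidef) (hH0 : H ≠ 0)
    (β : ℝ) (hβ0 : 0 ≤ β) (hβ1 : β < 1) (μ : ℝ) (hμ : 0 < μ) :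
    -- the critical step size in the mean
    IsLUB (ZOGDM.meanStableSteps P u c xstar H β μ)
        (2 * (1 + β) / ZOGDM.lambdaMax hH.isHermitian) ∧
      -- the critical step size in the mean-square
      ∃ ηms : ℝ, IsLUB (ZOGDM.msStableSteps P u c xstar H β μ) ηms ∧
        (0 < ηms ∧ ZOGDM.CriticalEquation hH.isHermitian β ηms) ∧
        (∀ η : ℝ, 0 < η → ZOGDM.CriticalEquation hH.isHermitian β η → η = ηms) ∧
        2 * (1 - β) / (H.trace + 2 * ZOGDM.lambdaMax hH.isHermitian / (1 + β)) ≤ ηms ∧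
        ηms ≤ 2 * (1 - β) / H.trace := by
  obtain ⟨i₀, hi₀, hmax, hpos⟩ := ZOGDM.exists_eigenvalue_eq_lambdaMax hH hH0
  have hl := hH.eigenvalues_nonneg
  have htr : H.trace = ∑ i, hH.isHermitian.eigenvalues i := by
    simpa using hH.isHermitian.trace_eq_sum_eigenvalues
  rw [htr, ← hi₀]
  -- Stability strictly below `b` and instability strictly above determine the supremum, whatever
  -- happens at `b`.
  have hlub : ∀ {s : Set ℝ} {b : ℝ}, 0 < b → (∀ η ∈ s, η ≤ b) → (∀ η, 0 < η → η < b → η ∈ s) →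
      IsLUB s b := by
    refine fun {s b} hb h1 h2 => ⟨h1, fun C hC => ?_⟩
    by_contra! hlt
    obtain ⟨η, hη1, hη2⟩ := exists_between (max_lt hb hlt)
    exact (hC (h2 η ((le_max_left _ _).trans_lt hη1) hη2)).not_gt
      ((le_max_right _ _).trans_lt hη1)
  have hmul : ∀ {η : ℝ}, 0 < η → ∀ j,
      η * hH.isHermitian.eigenvalues j ≤ η * hH.isHermitian.eigenvalues i₀ :=
    fun hη j => mul_le_mul_of_nonneg_left (hmax j) hη.le
  have hnn : ∀ {η : ℝ}, 0 < η → ∀ j, 0 ≤ η * hH.isHermitian.eigenvalues j :=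
    fun hη j => mul_nonneg hη.le (hl j)
  have hcrit : ∀ η, 0 < η → (ZOGDM.CriticalEquation hH.isHermitian β η ↔
      η * hH.isHermitian.eigenvalues i₀ < 1 - β ^ 2 ∧
        ZOGDM.criticalSum β hH.isHermitian.eigenvalues η = 1) := by
    intro η hη
    rw [ZOGDM.CriticalEquation, ← hi₀]
    refine and_congr_right fun h => ?_
    rw [ZOGDM.criticalSum, Finset.sum_congr rfl fun j _ =>
      ZOGDM.critical_term_eq hβ0 hβ1 ((hmul hη j).trans_lt h)]
  refine ⟨hlub (by positivity) ?_ ?_, ?_⟩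
  · rintro η ⟨_, hs⟩
    by_contra! hlt
    rw [div_lt_iff₀ hpos] at hlt
    exact ZOGDM.not_stableInMean_of_gt hu_indep hu_law hH.isHermitian hμ.ne' hβ0 hlt hs
  · intro η hη hlt
    rw [lt_div_iff₀ hpos] at hlt
    exact ⟨hη, ZOGDM.stableInMean_of_lt hu_indep hu_law hH.isHermitian hμ.ne' hβ0 hβ1 (hnn hη)
      fun j => (hmul hη j).trans_lt hlt⟩
  · obtain ⟨ηms, h0, h1, h2, h3, h4⟩ :=
      ZOGDM.exists_criticalSum_eq_one hβ0 hβ1 hl hmax hpos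
    refine ⟨ηms, hlub h0 ?_ ?_, ⟨h0, (hcrit _ h0).2 ⟨h1, h2⟩⟩, ?_, h3, h4⟩
    · rintro η ⟨hη, hs⟩
      by_contra! hlt
      refine ZOGDM.not_stableInMeanSquare hu_indep hu_law hH.isHermitian hμ.ne' hβ0 hβ1 (hnn hη)
        (mul_pos hη hpos) (hmul hη) (fun h => ?_) hs
      exact h2.symm.trans_lt (ZOGDM.criticalSum_lt_criticalSum hβ0 hl hmax hpos h0 hlt h)
    · intro η hη hlt
      refine ⟨hη, ZOGDM.stableInMeanSquare_of_sum_lt hu_indep hu_law hH.isHermitian hμ.ne' hβ0 hβ1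
        (hnn hη) (fun j => (hmul hη j).trans_lt
          ((mul_lt_mul_of_pos_right hlt hpos).trans h1)) ?_⟩
      exact (ZOGDM.criticalSum_lt_criticalSum hβ0 hl hmax hpos hη hlt h1).trans_eq h2
    · intro η hη hc
      obtain ⟨hc1, hc2⟩ := (hcrit η hη).1 hc
      rcases lt_trichotomy η ηms with hlt | heq | hlt
      · have := ZOGDM.criticalSum_lt_criticalSum hβ0 hl hmax hpos hη hlt h1
        linarith
      · exact heq
      · have := ZOGDM.criticalSum_lt_criticalSum hβ0 hl hmax hpos h0 hlt hc1
        linarith
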